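/- Let $q\ge 2$ and let $\mathfrak X$ be the $(q+1)$-homogeneous tree (vertex set, graph distance $d$) with a fixed reference vertex $o$. Let $\Omega$ be its boundary (half geodesics starting at $o$; equivalently, half geodesics up to meeting at infinity), with the topology generated by the cylinders $\Omega(x,y)$ = set of $\omega$ such that the half geodesic $[x,\omega)$ from $x$ to $\omega$ runs through $y$. For a vertex $x$ let $\nu_x$ be the Borel probability measure on $\Omega$ with $\nu_x(\Omega(x,y))=\frac1{(q+1)q^{n-1}}$ whenever $d(x,y)=n\ge1$, let $h_\omega(x)=\lim_{m\to\infty}(m-d(x,\omega_m))$, let $\Omega_n(x,\omega)=\Omega(x,x_n)$ where $x_n$ is the $n$-th vertex of $[x,\omega)$, and let $\mathcal E^x_n\eta(\omega)$ be the $\nu_x$-average of $\eta$ over $\Omega_n(x,\omega)$. Put $\tau=\pi/\log q$ and $d\mu(s)=c_P|\mathbf c(s)|^{-2}ds$ on $[0,\tau]$, where $c_P=\frac{q\log q}{4\pi(q+1)}$ and $\mathbf c(z)=\frac{q^{1/2}}{q+1}\,\frac{q^{1/2+iz}-q^{-1/2-iz}}{q^{iz}-q^{-iz}}$. For a symbol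 $a:\mathfrak X\times\Omega\times[0,\tau]\to\mathbb C$, $\mathrm{Op}(a)$ is the operator, defined on finitely supported functions on $\mathfrak X$, with kernel $$k_a(x,y)=\int_\Omega\int_0^\tau q^{(\frac12+is)(h_\omega(y)-h_\omega(x))}a(x,\omega,s)\,d\mu(s)\,d\nu_x(\omega).$$ A semi-classical symbol $a=a_\epsilon\in S_{sc}$ ($0<\epsilon<\epsilon_0$) is a family of such functions satisfying the following conditions, with constants independent of $\epsilon$: 1. for all $\epsilon$, $x$ and $k$, the derivative $\partial_s^k a_\epsilon(x,\cdot,\cdot)$ exists and is continuous on $\Omega\times[0,\tau]$; and for every $l\in\mathbb N$ there is $C_l$ with $\|(a_\epsilon-\mathcal E^x_na_\epsilon)(x,\cdot,\cdot)\|_\infty\le C_l(1+n)^{-l}$ for all $\epsilon,n,x$; 2. $\partial_s^ka_\epsilon(x,\omega,0)=\partial_s^ka_\epsilon(x,\omega,\tau)=0$ for all $\epsilon,k,x,\omega$; 3. (a) for every $k$ there is $C_k$ with $|\partial_s^ka_\epsilon(x,\omega,s)-\partial_s^ka_\epsilon(y,\omega,s)|\le C_k\,\epsilon\, d(x,y)$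 for all $\epsilon,x,y,\omega,s$; (b) for every $l$ there is a function $C_l(\cdot)$ with $|(a_\epsilon-\mathcal E^x_na_\epsilon)(x,\omega,s)-(a_\epsilon-\mathcal E^x_na_\epsilon)(y,\omega,s)|\le\epsilon\,C_l(d(x,y))(1+n)^{-l}$ for all $\epsilon,x,y,n,\omega,s$. **Theorem.** Let $a=a_\epsilon\in S_{sc}$. For every $\epsilon\in(0,\epsilon_0)$, $\mathrm{Op}(a)$ maps finitely supported functions into $L^2(\mathfrak X)=\ell^2(\mathfrak X)$, and both $\mathrm{Op}(\bar a)$ and the Hilbert space adjoint $\mathrm{Op}(a)^*$ are defined on all finitely supported functions. The operator $\mathrm{Op}(a)^*-\mathrm{Op}(\bar a)$ (on finitely supported functions) is $\epsilon$-negligible: it has a kernel $K_\epsilon(x,y)$ such that for every $N\in\mathbb N$ there is a function $C_N(\epsilon)$ with $C_N(\epsilon)\to0$ as $\epsilon\to0$ and $$|K_\epsilon(x,y)|\le C_N(\epsilon)\,\frac{q^{-d(x,y)/2}}{(1+d(x,y))^N}\qquad\text{for all }x,y\in\mathfrak X,\ 0<\epsilon<\epsilon_0 .$$ In particular it extends to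 a bounded operator on $L^2(\mathfrak X)$, and $$\|\mathrm{Op}(a)^*-\mathrm{Op}(\bar a)\|_{L^2\to L^2}\to0\quad\text{as }\epsilon\to0 .$$ Moreover, for each $\epsilon$ such that all the derivatives $\partial_s^ka_\epsilon$ are bounded on $\mathfrak X\times\Omega\times[0,\tau]$, $\mathrm{Op}(a)$ and $\mathrm{Op}(\bar a)$ themselves extend to bounded operators $A$, $A'$ on $L^2(\mathfrak X)$, and the above bounded extension of $\mathrm{Op}(a)^*-\mathrm{Op}(\bar a)$ is $A^*-A'$. -/

import Mathlib

open MeasureTheory Set Filter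
open scoped Topology ENNReal ComplexConjugate

namespace TreePDO

/-- `G` is the `(q+1)`-homogeneous tree, `q ≥ 2`. -/
class IsHomogeneousTree {V : Type*} (G : SimpleGraph V) (q : ℕ) : Prop where
  isTree : G.IsTree
  two_le : 2 ≤ q
  card_neighbors : ∀ x : V, (G.neighborSet x).ncard = q + 1

/-- Half geodesics. -/
def IsHalfGeodesic {V : Type*} (G : SimpleGraph V) (ρ : ℕ → V) : Prop :=
  ∀ i j : ℕ, (G.dist (ρ i) (ρ j) : ℤ) = |(i : ℤ) - (j : ℤ)|

/-- Two half geodesics meet at infinity. -/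
def MeetAtInfinity {V : Type*} (ρ ρ' : ℕ → V) : Prop :=
  ∃ j k : ℕ, ∀ n : ℕ, ρ (n + j) = ρ' (n + k)

/-- The boundary of the tree: half geodesics starting at the reference point `o`. -/
def Boundary {V : Type*} (G : SimpleGraph V) (o : V) : Type _ :=
  {ω : ℕ → V // IsHalfGeodesic G ω ∧ ω 0 = o}

/-- `ρ` is the half geodesic `[x, ω)`. -/
def IsRayTo {V : Type*} (G : SimpleGraph V) {o : V} (x : V) (ω : Boundary G o) (ρ : ℕ → V) :
    Prop :=
  IsHalfGeodesic G ρ ∧ ρ 0 = x ∧ MeetAtInfinity ρ ω.1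

/-- The cylinder `Ω(x, y)`: the `ω` such that `[x, ω)` runs through `y`. -/
def cylinder {V : Type*} (G : SimpleGraph V) (o x y : V) : Set (Boundary G o) :=
  {ω | ∃ ρ : ℕ → V, IsRayTo G x ω ρ ∧ y ∈ Set.range ρ}

instance {V : Type*} (G : SimpleGraph V) (o : V) : TopologicalSpace (Boundary G o) :=
  TopologicalSpace.generateFrom {U | ∃ x y : V, U = cylinder G o x y}

instance {V : Type*} (G : SimpleGraph V) (o : V) : MeasurableSpace (Boundary G o) :=
  borel (Boundary G o)

instance {V : Type*} (G : SimpleGraph V) (o : V) : BorelSpace (Boundary G o) := ⟨rfl⟩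

section TreeLemmas

variable {V : Type*} {G : SimpleGraph V}

lemma parent_unique (hG : G.IsTree) {x v w w' : V} (h : G.Adj v w) (h' : G.Adj v w')
    (hd : G.dist x w + 1 = G.dist x v) (hd' : G.dist x w' + 1 = G.dist x v) : w = w' := by
  obtain ⟨p, hp⟩ := hG.connected.exists_walk_length_eq_dist x w
  obtain ⟨p', hp'⟩ := hG.connected.exists_walk_length_eq_dist x w'
  have h1 : (p.concat h.symm).IsPath :=
    SimpleGraph.Walk.isPath_of_length_eq_dist _ (by simp [hp, hd])
  have h2 : (p'.concat h'.symm).IsPath :=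
    SimpleGraph.Walk.isPath_of_length_eq_dist _ (by simp [hp', hd'])
  have h3 := (hG.existsUnique_path x v).unique h1 h2
  have := congrArg SimpleGraph.Walk.penultimate h3
  simpa using this

lemma exists_parent (hG : G.IsTree) {x v : V} (hne : v ≠ x) :
    ∃ w, G.Adj v w ∧ G.dist x w + 1 = G.dist x v := by
  obtain ⟨p, hp⟩ := hG.connected.exists_walk_length_eq_dist v x
  cases p with
  | nil => exact absurd rfl hne
  | @cons _ w _ h p =>
    refine ⟨w, h, ?_⟩
    have h1 : G.dist w x ≤ p.length := SimpleGraph.dist_le p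
    simp only [SimpleGraph.Walk.length_cons] at hp
    have := hG.dist_eq_dist_add_one_of_adj x h
    rw [G.dist_comm (u := x) (v := w), G.dist_comm (u := x) (v := v)] at *
    omega

lemma dist_of_nonbacktracking (hG : G.IsTree) {ρ : ℕ → V} (hadj : ∀ n, G.Adj (ρ n) (ρ (n + 1)))
    (hnb : ∀ n, ρ (n + 2) ≠ ρ n) (n k : ℕ) : G.dist (ρ n) (ρ (n + k)) = k := by
  induction k using Nat.strong_induction_on with
  | _ k ih =>
    rcases k with _ | _ | k
    · simp
    · simpa using SimpleGraph.dist_eq_one_iff_adj.2 (hadj n)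
    · have h0 := ih k (by omega)
      have h1 := ih (k + 1) (by omega)
      have h2 := hG.dist_eq_dist_add_one_of_adj (ρ n) (hadj (n + (k + 1)))
      rcases h2 with h2 | h2
      · exfalso
        refine hnb (n + k) (parent_unique hG (x := ρ n) (v := ρ (n + (k + 1))) ?_ ?_ ?_ ?_)
        · exact hadj (n + (k + 1))
        · exact (hadj (n + k)).symm
        · have : n + k + 2 = n + (k + 1) + 1 := by ring
          rw [this, ← h2]
        · rw [h0, h1]
      · have : n + (k + 1 + 1) = n + (k + 1) + 1 := by ring
        rw [this, h2, h1]

lemma isHalfGeodesic_of_nonbacktracking (hG : G.IsTree) {ρ : ℕ → V}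
    (hadj : ∀ n, G.Adj (ρ n) (ρ (n + 1))) (hnb : ∀ n, ρ (n + 2) ≠ ρ n) : IsHalfGeodesic G ρ := by
  intro i j
  rcases le_total i j with h | h
  · obtain ⟨k, rfl⟩ := Nat.exists_eq_add_of_le h
    rw [dist_of_nonbacktracking hG hadj hnb]
    push_cast
    rw [show (i : ℤ) - (i + k) = -(k : ℤ) by ring, abs_neg, abs_of_nonneg (by positivity)]
  · obtain ⟨k, rfl⟩ := Nat.exists_eq_add_of_le h
    rw [G.dist_comm, dist_of_nonbacktracking hG hadj hnb]
    push_cast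
    rw [show (j : ℤ) + k - j = (k : ℤ) by ring, abs_of_nonneg (by positivity)]

lemma IsHalfGeodesic.dist_add {ρ : ℕ → V} (h : IsHalfGeodesic G ρ) (n k : ℕ) :
    G.dist (ρ n) (ρ (n + k)) = k := by
  have := h n (n + k)
  push_cast at this
  rw [show (n : ℤ) - (n + k) = -(k : ℤ) by ring, abs_neg, abs_of_nonneg (by positivity)] at this
  exact_mod_cast this

lemma IsHalfGeodesic.adj {ρ : ℕ → V} (h : IsHalfGeodesic G ρ) (n : ℕ) :
    G.Adj (ρ n) (ρ (n + 1)) :=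
  SimpleGraph.dist_eq_one_iff_adj.1 (h.dist_add n 1)

lemma IsHalfGeodesic.ne {ρ : ℕ → V} (h : IsHalfGeodesic G ρ) (n : ℕ) : ρ (n + 2) ≠ ρ n := by
  intro h2
  have := h.dist_add n 2
  rw [h2] at this
  simp at this

/-- Every half geodesic is equivalent to one starting at any prescribed vertex. -/
lemma exists_ray_from (hG : G.IsTree) (x : V) {ρ : ℕ → V} (hρ : IsHalfGeodesic G ρ) :
    ∃ ρ', IsHalfGeodesic G ρ' ∧ ρ' 0 = x ∧ MeetAtInfinity ρ' ρ := by
  have key : ∀ (y : V) (_ : G.Walk x y) (ρ : ℕ → V), IsHalfGeodesic G ρ → ρ 0 = y →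
      ∃ ρ', IsHalfGeodesic G ρ' ∧ ρ' 0 = x ∧ MeetAtInfinity ρ' ρ := by
    intro y p
    induction p with
    | nil => exact fun ρ h h0 => ⟨ρ, h, h0, 0, 0, fun _ => rfl⟩
    | @cons x z y hxz p ih =>
      intro ρ h h0
      obtain ⟨σ, hσ, hσ0, j, k, hjk⟩ := ih ρ h h0
      by_cases h1 : σ 1 = x
      · refine ⟨fun n => σ (n + 1), ?_, h1, j, k + 1, fun n => ?_⟩
        · intro i j
          have := hσ (i + 1) (j + 1)
          push_cast at this
          simpa using this
        · have := hjk (n + 1)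
          rw [show n + 1 + j = n + j + 1 by ring] at this
          change σ (n + j + 1) = _
          rw [this]
          congr 1; ring
      · refine ⟨fun n => Nat.casesOn n x σ, ?_, rfl, j + 1, k, fun n => hjk n⟩
        apply isHalfGeodesic_of_nonbacktracking hG
        · rintro (_ | n)
          · simpa [hσ0] using hxz
          · exact hσ.adj n
        · rintro (_ | n)
          · exact h1
          · exact hσ.ne n
  obtain ⟨p⟩ := hG.connected x (ρ 0)
  exact key _ p ρ hρ rfl

/-- A half geodesic from `z` passes through the points between `z` and any of its points. -/
lemma IsHalfGeodesic.mem_of_between (hG : G.IsTree) {ρ : ℕ → V} (hρ : IsHalfGeodesic G ρ)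
    (p : ℕ) {y : V} (h : G.dist (ρ 0) (ρ p) = G.dist (ρ 0) y + G.dist y (ρ p)) :
    ρ (G.dist (ρ 0) y) = y := by
  have hz : ∀ n, G.dist (ρ 0) (ρ n) = n := fun n => by simpa using hρ.dist_add 0 n
  induction hk : G.dist y (ρ p) generalizing y with
  | zero =>
    have := hG.connected.dist_eq_zero_iff.1 hk
    rw [this, hz]
  | succ k ih =>
    have hne : y ≠ ρ p := by rintro rfl; simp at hk
    obtain ⟨y', hadj, hd⟩ := exists_parent hG hne
    rw [G.dist_comm, G.dist_comm (u := ρ p) (v := y), hk] at hd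
    have ht := hG.connected.dist_triangle (u := ρ 0) (v := y') (w := ρ p)
    have h2 := hG.dist_eq_dist_add_one_of_adj (ρ 0) hadj
    have h3 : G.dist (ρ 0) y' = G.dist (ρ 0) y + 1 := by omega
    have h4 := ih (y := y') (by omega) (by omega)
    rw [h3] at h4
    refine parent_unique hG (x := ρ 0) (v := y') ?_ hadj.symm ?_ h3.symm
    · rw [← h4]; exact (hρ.adj _).symm
    · rw [hz, h3]

lemma MeetAtInfinity.symm {ρ ρ' : ℕ → V} (h : MeetAtInfinity ρ ρ') : MeetAtInfinity ρ' ρ := by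
  obtain ⟨j, k, h⟩ := h
  exact ⟨k, j, fun n => (h n).symm⟩

lemma MeetAtInfinity.trans {ρ ρ' ρ'' : ℕ → V} (h : MeetAtInfinity ρ ρ')
    (h' : MeetAtInfinity ρ' ρ'') : MeetAtInfinity ρ ρ'' := by
  obtain ⟨j, k, h⟩ := h
  obtain ⟨j', k', h'⟩ := h'
  refine ⟨j' + j, k + k', fun n => ?_⟩
  rw [show n + (j' + j) = n + j' + j by ring, h, show n + j' + k = n + k + j' by ring, h']
  congr 1; ring

/-- The cylinder `Ω(z, y)` in terms of any half geodesic representing the boundary point. -/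
lemma mem_cylinder_iff (hG : G.IsTree) {o z y : V} {ω : Boundary G o} {ρ : ℕ → V}
    (hm : MeetAtInfinity ρ ω.1) :
    ω ∈ cylinder G o z y ↔
      ∃ N, ∀ m ≥ N, G.dist z (ρ m) = G.dist z y + G.dist y (ρ m) := by
  constructor
  · rintro ⟨σ, ⟨hσ, h0, hσm⟩, n, hn⟩
    obtain ⟨j, k, hjk⟩ := hσm.trans hm.symm
    refine ⟨n + k, fun m hmn => ?_⟩
    obtain ⟨t, rfl⟩ := Nat.exists_eq_add_of_le hmn
    have h1 := hjk (n + t)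
    rw [show n + k + t = n + t + k by ring, ← h1, ← h0, ← hn]
    have e1 := hσ.dist_add 0 (n + t + j)
    have e2 := hσ.dist_add 0 n
    have e3 := hσ.dist_add n (t + j)
    simp only [zero_add] at e1 e2
    rw [e1, e2, show n + t + j = n + (t + j) by ring, e3]
  · rintro ⟨N, h⟩
    obtain ⟨σ, hσ, h0, hσm⟩ := exists_ray_from hG z ω.2.1
    obtain ⟨j, k, hjk⟩ := hσm.trans hm.symm
    refine ⟨σ, ⟨hσ, h0, hσm⟩, ?_⟩
    have h1 := h (N + k) (by omega)
    rw [← hjk N, ← h0] at h1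
    exact ⟨_, hσ.mem_of_between hG _ h1⟩

end TreeLemmas

section Existence

variable {V : Type*} {G : SimpleGraph V} {q : ℕ}

lemma neighborSet_finite (hG : IsHomogeneousTree G q) (x : V) : (G.neighborSet x).Finite :=
  Set.finite_of_ncard_pos (by rw [hG.card_neighbors]; omega)

lemma countable_vertices (hG : IsHomogeneousTree G q) (x : V) : Countable V := by
  have h : ∀ n, {v | G.dist x v = n}.Countable := by
    intro n
    induction n with
    | zero =>
      refine (Set.countable_singleton x).mono fun v hv => ?_
      exact (hG.isTree.connected.dist_eq_zero_iff.1 hv).symm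
    | succ n ih =>
      refine (ih.biUnion fun v _ => (neighborSet_finite hG v).countable).mono fun v hv => ?_
      have hne : v ≠ x := by rintro rfl; simp at hv
      obtain ⟨w, hw, hd⟩ := exists_parent hG.isTree hne
      have hv' : G.dist x v = n + 1 := hv
      exact Set.mem_biUnion (show G.dist x w = n by omega) hw.symm
  have h2 : (Set.univ : Set V).Countable :=
    (Set.countable_iUnion h).mono fun v _ => Set.mem_iUnion.2 ⟨G.dist x v, rfl⟩
  exact Set.countable_univ_iff.1 h2

/-- The neighbours of `v` that are farther from `x` than `v`. -/
def children (G : SimpleGraph V) (x v : V) : Set V :=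
  {w | G.Adj v w ∧ G.dist x w = G.dist x v + 1}

lemma children_ncard (hG : IsHomogeneousTree G q) (x v : V) [Decidable (v = x)] :
    (children G x v).ncard = if v = x then q + 1 else q := by
  split_ifs with h
  · subst h
    rw [← hG.card_neighbors v]
    congr 1
    ext w
    simp only [children, SimpleGraph.dist_self, zero_add, Set.mem_ofPred_eq,
      SimpleGraph.mem_neighborSet, SimpleGraph.dist_eq_one_iff_adj, and_self]
  · obtain ⟨p, hp, hd⟩ := exists_parent hG.isTree h
    have : children G x v = G.neighborSet v \ {p} := by
      ext w
      constructor
      · rintro ⟨h1, h2⟩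
        refine ⟨h1, ?_⟩
        rintro rfl
        omega
      · rintro ⟨h1, h2⟩
        refine ⟨h1, ?_⟩
        rcases hG.isTree.dist_eq_dist_add_one_of_adj x h1 with h3 | h3
        · exact absurd (parent_unique hG.isTree h1 hp h3.symm hd) h2
        · exact h3
    rw [this, Set.ncard_sdiff_singleton_of_mem (show p ∈ G.neighborSet v from hp),
      hG.card_neighbors]
    rfl

lemma children_finite (hG : IsHomogeneousTree G q) (x v : V) : (children G x v).Finite :=
  (neighborSet_finite hG v).subset fun _ h => h.1

lemma children_nonempty (hG : IsHomogeneousTree G q) (x v : V) : (children G x v).Nonempty := by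
  classical
  refine Set.nonempty_of_ncard_ne_zero ?_
  rw [children_ncard hG]
  have := hG.two_le
  split_ifs <;> omega

/-- The vertices reached from `x` when a child is chosen at each vertex. -/
def walkOut (x : V) (ξ : (v : V) → children G x v) : ℕ → V
  | 0 => x
  | n + 1 => (ξ (walkOut x ξ n)).1

lemma dist_walkOut (x : V) (ξ : (v : V) → children G x v) (n : ℕ) :
    G.dist x (walkOut x ξ n) = n := by
  induction n with
  | zero => simp [walkOut]
  | succ n ih => rw [walkOut, (ξ _).2.2, ih]

lemma walkOut_isHalfGeodesic (hG : G.IsTree) (x : V) (ξ : (v : V) → children G x v) :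
    IsHalfGeodesic G (walkOut x ξ) := by
  refine isHalfGeodesic_of_nonbacktracking hG (fun n => (ξ _).2.1) fun n h => ?_
  have h1 := dist_walkOut x ξ (n + 2)
  rw [h, dist_walkOut] at h1
  omega

/-- The mass of a cylinder at distance `n`. -/
noncomputable def cylinderMass (q : ℕ) : ℕ → ℝ≥0∞
  | 0 => 1
  | n + 1 => (((q : ℝ≥0∞) + 1) * (q : ℝ≥0∞) ^ n)⁻¹

lemma cylinderMass_succ (hG : IsHomogeneousTree G q) (x p : V) :
    cylinderMass q (G.dist x p) * ((children G x p).ncard : ℝ≥0∞)⁻¹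
      = cylinderMass q (G.dist x p + 1) := by
  classical
  rw [children_ncard hG]
  have hq := hG.two_le
  have hq0 : (q : ℝ≥0∞) ≠ 0 := by simp; omega
  split_ifs with h
  · subst h; simp [cylinderMass]
  · obtain ⟨n, hn⟩ : ∃ n, G.dist x p = n + 1 :=
      Nat.exists_eq_succ_of_ne_zero (hG.isTree.connected.pos_dist_of_ne (Ne.symm h)).ne'
    rw [hn, cylinderMass, cylinderMass, pow_succ, ← mul_assoc,
      ENNReal.mul_inv (a := ((q : ℝ≥0∞) + 1) * (q : ℝ≥0∞) ^ n)]
    · right; simp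
    · right; exact hq0

/-- The harmonic probability measure seen from `x` gives the mass `1 / ((q+1) q^(n-1))` to each
cylinder `Ω(x, y)` with `d(x, y) = n ≥ 1`. -/
def IsBoundaryMeasure (G : SimpleGraph V) (q : ℕ) (o x : V) (μ : Measure (Boundary G o)) : Prop :=
  IsProbabilityMeasure μ ∧
    ∀ (n : ℕ) (y : V), 1 ≤ n → G.dist x y = n →
      μ (cylinder G o x y) = (((q : ℝ≥0∞) + 1) * (q : ℝ≥0∞) ^ (n - 1))⁻¹

lemma exists_boundaryMeasure (hG : IsHomogeneousTree G q) (o x : V) :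
    ∃ μ : Measure (Boundary G o), IsBoundaryMeasure G q o x μ := by
  classical
  have hT := hG.isTree
  have : Countable V := countable_vertices hG x
  let : MeasurableSpace V := ⊤
  let hfin : ∀ v, Fintype (children G x v) := fun v => (children_finite hG x v).fintype
  have : ∀ v, Nonempty (children G x v) := fun v => (children_nonempty hG x v).to_subtype
  let : ∀ v, MeasurableSpace (children G x v) := fun v => ⊤
  let m : (v : V) → Measure (children G x v) :=
    fun v => (PMF.uniformOfFintype (children G x v)).toMeasure
  have : ∀ v, IsProbabilityMeasure (m v) := fun v => by dsimp only [m]; infer_instance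
  let P : Measure ((v : V) → children G x v) := Measure.infinitePi m
  have hm : ∀ v (w : children G x v), m v {w} = ((children G x v).ncard : ℝ≥0∞)⁻¹ := by
    intro v w
    dsimp only [m]
    rw [PMF.toMeasure_apply_singleton _ _ (MeasurableSpace.measurableSet_top)]
    rw [PMF.uniformOfFintype_apply, ← Nat.card_eq_fintype_card, Nat.card_coe_set_eq]
  -- probability of reaching a given vertex
  have hreach : ∀ (n : ℕ) (y : V), G.dist x y = n →
      ∃ (s : Finset V) (t : (v : V) → Set (children G x v)), (∀ v ∈ s, G.dist x v < n) ∧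
        {ξ | walkOut x ξ n = y} = Set.pi s t ∧ ∏ v ∈ s, m v (t v) = cylinderMass q n := by
    intro n
    induction n with
    | zero =>
      intro y hy
      have := hT.connected.dist_eq_zero_iff.1 hy
      refine ⟨∅, fun _ => Set.univ, by simp, ?_, by simp [cylinderMass]⟩
      ext ξ; simp [walkOut, this]
    | succ n ih =>
      intro y hy
      have hne : y ≠ x := by rintro rfl; simp at hy
      obtain ⟨p, hp, hd⟩ := exists_parent hT hne
      have hpn : G.dist x p = n := by omega
      obtain ⟨s, t, h1, h2, h3⟩ := ih p hpn
      have hps : p ∉ s := fun h => by have := h1 p h; omega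
      let y' : children G x p := ⟨y, hp.symm, hd.symm⟩
      refine ⟨insert p s, Function.update t p {y'}, ?_, ?_, ?_⟩
      · intro v hv
        rcases Finset.mem_insert.1 hv with rfl | hv
        · omega
        · have := h1 v hv; omega
      · have h4 : ∀ ξ : (v : V) → children G x v, walkOut x ξ (n + 1) = y ↔
            walkOut x ξ n = p ∧ ξ p = y' := by
          intro ξ
          constructor
          · intro h
            have h5 : walkOut x ξ n = p := by
              refine parent_unique hT (x := x) (v := y) ?_ hp ?_ hd
              · rw [← h]; exact (ξ _).2.1.symm
              · rw [dist_walkOut, hy]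
            refine ⟨h5, Subtype.ext ?_⟩
            rw [walkOut, h5] at h
            exact h
          · rintro ⟨h5, h6⟩
            rw [walkOut, h5, h6]
        ext ξ
        have h7 : walkOut x ξ n = p ↔ ξ ∈ Set.pi (s : Set V) t := by rw [← h2]; rfl
        simp only [Set.mem_ofPred_eq, h4, h7, Set.mem_pi, Finset.coe_insert,
          Set.forall_mem_insert, Function.update_self, Set.mem_singleton_iff]
        rw [and_comm]
        refine and_congr_right fun _ => forall₂_congr fun v hv => ?_
        rw [Function.update_of_ne (by rintro rfl; exact hps hv)]
      · rw [Finset.prod_insert hps, Function.update_self, hm, mul_comm]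
        rw [Finset.prod_congr rfl (g := fun v => m v (t v)), h3, ← hpn, cylinderMass_succ hG]
        intro v hv
        rw [Function.update_of_ne (by rintro rfl; exact hps hv)]
  have hPreach : ∀ (n : ℕ) (y : V), G.dist x y = n →
      P {ξ | walkOut x ξ n = y} = cylinderMass q n := by
    intro n y hy
    obtain ⟨s, t, -, h2, h3⟩ := hreach n y hy
    rw [h2, ← h3]
    exact Measure.infinitePi_pi _ fun v _ => MeasurableSpace.measurableSet_top
  -- the corresponding boundary point
  have hex : ∀ ξ : (v : V) → children G x v, ∃ ω : Boundary G o,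
      MeetAtInfinity (walkOut x ξ) ω.1 := by
    intro ξ
    obtain ⟨σ, h1, h2, h3⟩ := exists_ray_from hT o (walkOut_isHalfGeodesic hT x ξ)
    exact ⟨⟨σ, h1, h2⟩, h3.symm⟩
  choose T hTm using hex
  have hmeasOut : ∀ n, Measurable fun ξ : (v : V) → children G x v => walkOut x ξ n := by
    intro n
    induction n with
    | zero => exact measurable_const
    | succ n ih =>
      refine measurable_to_countable' fun w => ?_
      have : (fun ξ : (v : V) → children G x v => walkOut x ξ (n + 1)) ⁻¹' {w} =
          ⋃ v : V, {ξ | walkOut x ξ n = v} ∩ (fun ξ => ξ v) ⁻¹' {c | c.1 = w} := by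
        ext ξ
        simp [walkOut]
      rw [this]
      exact MeasurableSet.iUnion fun v =>
        (ih (MeasurableSpace.measurableSet_top (s := {v}))).inter
          (measurable_pi_apply v MeasurableSpace.measurableSet_top)
  have hsub : ∀ z y : V, MeasurableSet (T ⁻¹' cylinder G o z y) := by
    intro z y
    have : T ⁻¹' cylinder G o z y = ⋃ N : ℕ, ⋂ k : ℕ, ⋂ _ : k ≥ N,
        (fun ξ => walkOut x ξ k) ⁻¹' {v | G.dist z v = G.dist z y + G.dist y v} := by
      ext ξ
      simp [mem_cylinder_iff hT (hTm ξ)]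
    rw [this]
    exact MeasurableSet.iUnion fun N => MeasurableSet.iInter fun k => MeasurableSet.iInter fun _ =>
      hmeasOut k MeasurableSpace.measurableSet_top
  have hcount : {U | ∃ x y : V, U = cylinder G o x y}.Countable := by
    refine (Set.countable_range fun p : V × V => cylinder G o p.1 p.2).mono ?_
    rintro U ⟨a, b, rfl⟩
    exact ⟨(a, b), rfl⟩
  have : SecondCountableTopology (Boundary G o) :=
    SecondCountableTopology.mk ⟨_, hcount, rfl⟩
  have hborel : borel (Boundary G o) =
      MeasurableSpace.generateFrom {U | ∃ x y : V, U = cylinder G o x y} :=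
    borel_eq_generateFrom_of_subbasis rfl
  have hTmeas : Measurable T := by
    have : @Measurable _ _ _
        (MeasurableSpace.generateFrom {U | ∃ x y : V, U = cylinder G o x y}) T := by
      refine measurable_generateFrom ?_
      rintro U ⟨a, b, rfl⟩
      exact hsub a b
    rw [← hborel] at this
    exact this
  have hopen : ∀ z y : V, MeasurableSet (cylinder G o z y) := fun z y =>
    (show IsOpen (cylinder G o z y) from
      TopologicalSpace.isOpen_generateFrom_of_mem ⟨z, y, rfl⟩).measurableSet
  refine ⟨P.map T, Measure.isProbabilityMeasure_map hTmeas.aemeasurable, fun n y hn hy => ?_⟩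
  rw [Measure.map_apply hTmeas (hopen x y)]
  have : T ⁻¹' cylinder G o x y = {ξ | walkOut x ξ n = y} := by
    ext ξ
    have hgeo := walkOut_isHalfGeodesic hT x ξ
    constructor
    · intro h
      obtain ⟨N, h⟩ := (mem_cylinder_iff hT (hTm ξ)).1 h
      have := hgeo.mem_of_between hT N (y := y) (h N le_rfl)
      change walkOut x ξ (G.dist x y) = y at this
      rwa [hy] at this
    · intro h
      exact ⟨walkOut x ξ, ⟨hgeo, rfl, hTm ξ⟩, n, h⟩
  rw [this, hPreach n y hy]
  obtain ⟨k, rfl⟩ := Nat.exists_eq_add_of_le' hn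
  rfl

end Existence

/-! ### Fourier analysis on the tree -/

/-- The probability measure `ν_x` on the boundary. -/
noncomputable def boundaryMeasure {V : Type*} (G : SimpleGraph V) (q : ℕ)
    [hG : IsHomogeneousTree G q] (o x : V) : Measure (Boundary G o) :=
  (exists_boundaryMeasure hG o x).choose

/-- The height function `h_ω(x) = lim (m - d(x, ω_m))`. -/
noncomputable def height {V : Type*} (G : SimpleGraph V) {o : V} (ω : Boundary G o) (x : V) : ℤ :=
  limUnder atTop fun m : ℕ => (m : ℤ) - (G.dist x (ω.1 m) : ℤ)

/-- `Ω_n(x, ω) = Ω(x, x_n)`, where `x_n` is the point of `[x, ω)` at distance `n` from `x`. -/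
def truncCylinder {V : Type*} (G : SimpleGraph V) {o : V} (n : ℕ) (x : V) (ω : Boundary G o) :
    Set (Boundary G o) :=
  {ω' | ∃ y : V, G.dist x y = n ∧ ω ∈ cylinder G o x y ∧ ω' ∈ cylinder G o x y}

/-- The averaging operator `ℰ_n^x`. -/
noncomputable def avg {V : Type*} (G : SimpleGraph V) (q : ℕ) [IsHomogeneousTree G q] {o : V}
    (x : V) (n : ℕ) (η : Boundary G o → ℂ) (ω : Boundary G o) : ℂ :=
  ⨍ ω' in truncCylinder G n x ω, η ω' ∂(boundaryMeasure G q o x)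

/-- `τ = π / log q`. -/
noncomputable def tau (q : ℕ) : ℝ := Real.pi / Real.log q

/-- The Harish-Chandra function `𝐜`. -/
noncomputable def cFun (q : ℕ) (z : ℂ) : ℂ :=
  (q : ℂ) ^ (1 / 2 : ℂ) / ((q : ℂ) + 1) *
    (((q : ℂ) ^ (1 / 2 + Complex.I * z) - (q : ℂ) ^ (-(1 / 2) - Complex.I * z)) /
      ((q : ℂ) ^ (Complex.I * z) - (q : ℂ) ^ (-(Complex.I * z))))

/-- The density `c_P |𝐜(s)|⁻²` of the Plancherel measure `dμ(s)`. -/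
noncomputable def plancherelDensity (q : ℕ) (s : ℝ) : ℝ :=
  (q * Real.log q) / (4 * Real.pi * (q + 1)) * (‖cFun q (s : ℂ)‖ ^ 2)⁻¹

/-- The kernel `k_a(x, y)` of `Op(a)`. -/
noncomputable def kernel {V : Type*} (G : SimpleGraph V) (q : ℕ) [IsHomogeneousTree G q] {o : V}
    (a : V → Boundary G o → ℝ → ℂ) (x y : V) : ℂ :=
  ∫ ω, (∫ s in (0 : ℝ)..tau q,
      (q : ℂ) ^ ((1 / 2 + Complex.I * (s : ℂ)) * ((height G ω y - height G ω x : ℤ) : ℂ)) *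
        a x ω s * (plancherelDensity q s : ℂ)) ∂(boundaryMeasure G q o x)

/-! ### Symbols -/

/-- `∂_s^k f` on the interval `[0, τ]` (one-sided derivatives at the end points). -/
noncomputable def derivS (q k : ℕ) (f : ℝ → ℂ) (s : ℝ) : ℂ :=
  iteratedDerivWithin k f (Set.Icc 0 (tau q)) s

/-- Families `a ε`, `0 < ε < ε₀`, of symbols on `𝔛 × Ω × [0, τ]` which are semi-classical; all the
constants are independent of `ε`. -/
structure IsSemiclassicalSymbol {V : Type*} (G : SimpleGraph V) (q : ℕ) [IsHomogeneousTree G q]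
    {o : V} (ε₀ : ℝ) (a : ℝ → V → Boundary G o → ℝ → ℂ) : Prop where
  smooth : ∀ ε ∈ Set.Ioo 0 ε₀, ∀ x ω,
    ContDiffOn ℝ ((⊤ : ℕ∞) : WithTop ℕ∞) (a ε x ω) (Set.Icc 0 (tau q))
  continuous_deriv : ∀ ε ∈ Set.Ioo 0 ε₀, ∀ x, ∀ k : ℕ,
    ContinuousOn (fun p : Boundary G o × ℝ => derivS q k (a ε x p.1) p.2)
      (Set.univ ×ˢ Set.Icc 0 (tau q))
  regular : ∀ l : ℕ, ∃ C : ℝ, ∀ ε ∈ Set.Ioo 0 ε₀, ∀ (n : ℕ) (x : V) (ω : Boundary G o),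
    ∀ s ∈ Set.Icc 0 (tau q),
      ‖a ε x ω s - avg G q x n (fun ω' => a ε x ω' s) ω‖ ≤ C / (1 + (n : ℝ)) ^ l
  boundary : ∀ ε ∈ Set.Ioo 0 ε₀, ∀ (k : ℕ) (x : V) (ω : Boundary G o),
    derivS q k (a ε x ω) 0 = 0 ∧ derivS q k (a ε x ω) (tau q) = 0
  -- the constant may depend on the order `k` of the derivative
  lipschitz : ∀ k : ℕ, ∃ C : ℝ, ∀ ε ∈ Set.Ioo 0 ε₀, ∀ (x y : V) (ω : Boundary G o),
    ∀ s ∈ Set.Icc 0 (tau q),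
      ‖derivS q k (a ε x ω) s - derivS q k (a ε y ω) s‖ ≤ C * ε * (G.dist x y : ℝ)
  cross : ∀ l : ℕ, ∃ C : ℕ → ℝ, ∀ ε ∈ Set.Ioo 0 ε₀, ∀ (x y : V) (n : ℕ) (ω : Boundary G o),
    ∀ s ∈ Set.Icc 0 (tau q),
      ‖(a ε x ω s - avg G q x n (fun ω' => a ε x ω' s) ω) -
          (a ε y ω s - avg G q x n (fun ω' => a ε y ω' s) ω)‖ ≤
        ε * (C (G.dist x y) / (1 + (n : ℝ)) ^ l)

/-! ### Operators -/

/-- The Hilbert space `L²(𝔛)`. -/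
noncomputable abbrev L2 (V : Type*) := lp (fun _ : V => ℂ) 2

/-- The finitely supported functions in `L²(𝔛)`. -/
noncomputable def finSupp (V : Type*) : Submodule ℂ (L2 V) where
  carrier := {u | (Function.support (u : V → ℂ)).Finite}
  zero_mem' := by
    rw [Set.mem_ofPred_eq, lp.coeFn_zero]
    simp
  add_mem' := fun {u v} hu hv => by
    refine (hu.union hv).subset ?_
    rw [lp.coeFn_add]
    exact Function.support_add _ _
  smul_mem' := fun c u hu => by
    refine hu.subset ?_
    rw [lp.coeFn_smul]
    exact Function.support_const_smul_subset c _

/-- The action of a kernel on (finitely supported) functions. -/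
noncomputable def applyKernel {V : Type*} (K : V → V → ℂ) (u : V → ℂ) (x : V) : ℂ :=
  ∑ᶠ y, K x y * u y

lemma applyKernel_add {V : Type*} (K : V → V → ℂ) {u v : V → ℂ}
    (hu : (Function.support u).Finite) (hv : (Function.support v).Finite) :
    applyKernel K (u + v) = applyKernel K u + applyKernel K v := by
  funext x
  have h : ∀ w : V → ℂ, (Function.support fun y => K x y * w y) ⊆ Function.support w :=
    fun w y hy h0 => hy (by simp [h0])
  simp only [applyKernel, Pi.add_apply, mul_add]
  exact finsum_add_distrib (hu.subset (h u)) (hv.subset (h v))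

lemma applyKernel_smul {V : Type*} (K : V → V → ℂ) (c : ℂ) {u : V → ℂ}
    (hu : (Function.support u).Finite) : applyKernel K (c • u) = c • applyKernel K u := by
  funext x
  have h : (Function.support fun y => K x y * u y) ⊆ Function.support u :=
    fun y hy h0 => hy (by simp [h0])
  simp only [applyKernel, Pi.smul_apply, smul_eq_mul, mul_left_comm _ c]
  exact (mul_finsum' _ _ (hu.subset h)).symm

/-- The operator with kernel `K`, as a densely defined operator on `L²(𝔛)`; its domain consists of
the finitely supported functions (whose image belongs to `L²(𝔛)`). -/
noncomputable def kernelOperator {V : Type*} (K : V → V → ℂ) : L2 V →ₗ.[ℂ] L2 V where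
  domain :=
    { carrier := {u | u ∈ finSupp V ∧ Memℓp (E := fun _ : V => ℂ) (applyKernel K u) 2}
      zero_mem' := by
        refine ⟨zero_mem _, ?_⟩
        have : applyKernel K ((0 : L2 V) : V → ℂ) = 0 := by
          funext x; simp [applyKernel]
        rw [this]
        exact zero_memℓp
      add_mem' := fun {u v} hu hv => by
        refine ⟨add_mem hu.1 hv.1, ?_⟩
        rw [lp.coeFn_add, applyKernel_add K hu.1 hv.1]
        exact hu.2.add hv.2
      smul_mem' := fun c u hu => by
        refine ⟨Submodule.smul_mem _ c hu.1, ?_⟩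
        rw [lp.coeFn_smul, applyKernel_smul K c hu.1]
        exact hu.2.const_smul c }
  toFun :=
    { toFun := fun u => ⟨applyKernel K u.1, u.2.2⟩
      map_add' := fun u v => Subtype.ext (applyKernel_add K u.2.1 v.2.1)
      map_smul' := fun c u => Subtype.ext (applyKernel_smul K c u.2.1) }

/-- `Op(a)`, with domain the finitely supported functions. -/
noncomputable def Op {V : Type*} (G : SimpleGraph V) (q : ℕ) [IsHomogeneousTree G q] {o : V}
    (a : V → Boundary G o → ℝ → ℂ) : L2 V →ₗ.[ℂ] L2 V :=
  kernelOperator (kernel G q a)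

/-- The complex conjugate symbol `ā`. -/
def conjSymbol {V B : Type*} (a : V → B → ℝ → ℂ) : V → B → ℝ → ℂ :=
  fun x ω s => conj (a x ω s)

/-- The family of operators `A ε`, `0 < ε < ε₀`, is `ε`-negligible. -/
def IsNegligible {V : Type*} (G : SimpleGraph V) (q : ℕ) (ε₀ : ℝ) (A : ℝ → (L2 V →ₗ.[ℂ] L2 V)) :
    Prop :=
  ∃ K : ℝ → V → V → ℂ, (∀ ε ∈ Set.Ioo 0 ε₀, A ε = kernelOperator (K ε)) ∧
    ∀ N : ℕ, ∃ C : ℝ → ℝ, Tendsto C (𝓝[>] 0) (𝓝 0) ∧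
      ∀ ε ∈ Set.Ioo 0 ε₀, ∀ x y : V,
        ‖K ε x y‖ ≤ C ε * ((q : ℝ) ^ (-(G.dist x y : ℝ) / 2) / (1 + (G.dist x y : ℝ)) ^ N)

/-- The bounded operator `T` on `L²(𝔛)` extends the densely defined operator `A`. -/
def IsBoundedExtension {V : Type*} (A : L2 V →ₗ.[ℂ] L2 V) (T : L2 V →L[ℂ] L2 V) : Prop :=
  ∀ u : A.domain, T (u : L2 V) = A u

end TreePDO

namespace TreePDO

/-! ### Geometry of the tree -/

section Geometry

variable {V : Type*} {G : SimpleGraph V}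

/-! Write `H = h_ω(y) - h_ω(x)` and `d = d(x, y)`. Then `H = 2j - d`, where `j` is the number of
edges that `[x, ω)` shares with `[x, y]`. The level `H = 2j - d` has `ν_x`-mass at most `q^{-j}`, so
after multiplication by `q^{H/2}` each of the `d + 1` levels contributes about `q^{-d/2}`. The
remaining integral in `s` is the `H`-th Fourier coefficient of a function that is flat at both ends
of `[0, τ]`; integration by parts makes it decay rapidly in `|H|`.

This says nothing when `|H|` is small compared with `d`. There, however, `ω` follows `[x, y]` for at
least `d/4` steps, and by the regularity condition the symbol is almost independent of such `ω`.
Once the symbol is frozen, the sum over the middle levels telescopes: these levels carry masses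
exactly proportional to `q^{-j}` (`measureReal_level`), and the Plancherel density contains the
factor `q^{2is} - 1`, so each coefficient is a difference of coefficients with indices `H + 2` and
`H` (`fourierCoeff_plancherel`). Only end terms with index at least about `d/2` survive. This is
`exists_boundaryKernel_bound`.

Since `dν_y = q^H dν_x` (`boundaryMeasure_eq_withDensity`), the adjoint kernel is again an integral
against `ν_x`, with the conjugate symbol taken at `y` in place of `x` (`conj_boundaryKernel`). Hence
`Op(a)* - Op(ā)` has the kernel built from `ā(y, ·) - ā(x, ·)`. The Lipschitz condition bounds it by
`O(ε) q^{-d/2} (1 + d)^2`; the main estimate bounds it by `q^{-d/2} (1 + d)^{-N}` uniformly in `ε`.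
The geometric mean of the two gives `√ε` together with arbitrary decay.

Boundedness on `L²` is a Schur test with weight `q^{h_ω(x)/2}` for a fixed `ω`
(`isSchurKernel_decayKernel`). Bounds on single rows and columns of the kernel of `Op(a)` suffice to
identify the unbounded adjoint on finitely supported functions (`adjoint_sub_kernelOperator`). -/

lemma exists_between (hG : G.IsTree) (x y : V) {n : ℕ} (hn : n ≤ G.dist x y) :
    ∃ v, G.dist x v = n ∧ G.dist x y = G.dist x v + G.dist v y := by
  obtain ⟨k, hk⟩ := Nat.exists_eq_add_of_le hn
  induction k generalizing n with
  | zero => exact ⟨y, by omega, by simp⟩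
  | succ k ih =>
    obtain ⟨v, h1, h2⟩ := ih (n := n + 1) (by omega) (by omega)
    obtain ⟨w, hw, hd⟩ := exists_parent hG (x := x) (v := v) (by rintro rfl; simp at h1)
    have h3 := hG.connected.dist_triangle (u := x) (v := w) (w := y)
    have h4 := hG.connected.dist_triangle (u := w) (v := v) (w := y)
    have h5 := SimpleGraph.dist_eq_one_iff_adj.2 hw.symm
    exact ⟨w, by omega, by omega⟩

/-- Move both points one step towards `y`. By induction the new points coincide, and a vertex has
only one neighbour closer to `x`. -/
lemma between_unique (hG : G.IsTree) {x y v v' : V} (h : G.dist x y = G.dist x v + G.dist v y)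
    (h' : G.dist x y = G.dist x v' + G.dist v' y) (hv : G.dist x v = G.dist x v') : v = v' := by
  induction hk : G.dist v y generalizing v v' with
  | zero =>
    have h1 := hG.connected.dist_eq_zero_iff.1 hk
    have h2 := hG.connected.dist_eq_zero_iff.1 (show G.dist v' y = 0 by omega)
    rw [h1, h2]
  | succ k ih =>
    obtain ⟨w, hw, hd⟩ := exists_parent hG (x := y) (v := v) (by rintro rfl; simp at hk)
    obtain ⟨w', hw', hd'⟩ := exists_parent hG (x := y) (v := v') (by
      rintro rfl
      simp at h'
      omega)
    have t1 := hG.connected.dist_triangle (u := x) (v := w) (w := y)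
    have t2 := hG.connected.dist_triangle (u := x) (v := v) (w := w)
    have t3 := hG.connected.dist_triangle (u := x) (v := w') (w := y)
    have t4 := hG.connected.dist_triangle (u := x) (v := v') (w := w')
    have e1 := SimpleGraph.dist_eq_one_iff_adj.2 hw
    have e2 := SimpleGraph.dist_eq_one_iff_adj.2 hw'
    rw [G.dist_comm (u := y) (v := w), G.dist_comm (u := y) (v := v)] at hd
    rw [G.dist_comm (u := y) (v := w'), G.dist_comm (u := y) (v := v')] at hd'
    have hww : w = w' := ih (by omega) (by omega) (by omega) (by omega)
    subst hww
    exact parent_unique hG (x := x) (v := w) hw.symm hw'.symm (by omega) (by omega)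

lemma between_order (hG : G.IsTree) {x p c z : V} (hc : G.dist x p = G.dist x c + G.dist c p)
    (hz : G.dist x p = G.dist x z + G.dist z p) (hcz : G.dist x c ≤ G.dist x z) :
    G.dist x z = G.dist x c + G.dist c z ∧ G.dist c p = G.dist c z + G.dist z p := by
  obtain ⟨z', h1, h2⟩ := exists_between hG c p (n := G.dist x z - G.dist x c) (by omega)
  have t1 := hG.connected.dist_triangle (u := x) (v := c) (w := z')
  have t2 := hG.connected.dist_triangle (u := x) (v := z') (w := p)
  obtain rfl : z = z' := between_unique hG (x := x) (y := p) hz (by omega) (by omega)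
  omega

/-- Any three vertices of a tree have a median. -/
lemma exists_median (hG : G.IsTree) (x y p : V) : ∃ c, G.dist x y = G.dist x c + G.dist c y ∧
    G.dist x p = G.dist x c + G.dist c p ∧ G.dist y p = G.dist y c + G.dist c p := by
  induction hk : G.dist x y generalizing y with
  | zero =>
    obtain rfl := hG.connected.dist_eq_zero_iff.1 hk
    exact ⟨x, by simp, by simp, by simp⟩
  | succ k ih =>
    obtain ⟨y', hy, hd⟩ := exists_parent hG (x := x) (v := y) (by rintro rfl; simp at hk)
    obtain ⟨c, h1, h2, h3⟩ := ih y' (by omega)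
    have e1 := SimpleGraph.dist_eq_one_iff_adj.2 hy
    have t1 := hG.connected.dist_triangle (u := x) (v := c) (w := y)
    have t2 := hG.connected.dist_triangle (u := c) (v := y') (w := y)
    have t3 := hG.connected.dist_triangle (u := y) (v := c) (w := p)
    have c1 := G.dist_comm (u := y) (v := y')
    have c2 := G.dist_comm (u := y) (v := c)
    have c3 := G.dist_comm (u := y') (v := c)
    rcases hG.dist_eq_dist_add_one_of_adj p hy with h | h
    · rw [G.dist_comm (u := p) (v := y), G.dist_comm (u := p) (v := y')] at h
      exact ⟨c, by omega, by omega, by omega⟩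
    · rw [G.dist_comm (u := p) (v := y), G.dist_comm (u := p) (v := y')] at h
      by_cases hc : y' = c
      · subst hc
        have t4 := hG.connected.dist_triangle (u := x) (v := y) (w := p)
        exact ⟨y, by simp [hk], by omega, by simp⟩
      -- Here `y` and the neighbour `w` of `y'` towards `c` are both closer to `p` than `y'`, so
      -- they agree; but `y` is farther from `x` than `y'`, and `w` is closer.
      · exfalso
        obtain ⟨w, hw, hwd⟩ := exists_parent hG (x := c) (v := y') hc
        have t5 := hG.connected.dist_triangle (u := p) (v := c) (w := w)
        have t6 := hG.connected.dist_triangle (u := p) (v := w) (w := y')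
        have t7 := hG.connected.dist_triangle (u := x) (v := c) (w := w)
        have e2 := SimpleGraph.dist_eq_one_iff_adj.2 hw.symm
        have c4 := G.dist_comm (u := p) (v := y')
        have c5 := G.dist_comm (u := p) (v := c)
        have c6 := G.dist_comm (u := p) (v := y)
        have := parent_unique hG (x := p) (v := y') hw hy.symm (by omega) (by omega)
        subst this
        omega

/-! ### Heights and cylinders -/

variable {o : V}

lemma mem_cylinder_iff_eventually (hG : G.IsTree) {z y : V} {ω : Boundary G o} :
    ω ∈ cylinder G o z y ↔
      ∀ᶠ m in atTop, G.dist z (ω.1 m) = G.dist z y + G.dist y (ω.1 m) := by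
  rw [mem_cylinder_iff hG (ρ := ω.1) ⟨0, 0, fun _ => rfl⟩, eventually_atTop]

/-- The ray from `x` merges with `ω`, so the sequence defining the height is eventually constant.
Statements on heights thus become linear arithmetic of distances to a single far point `ω_m`. -/
lemma height_eventually (hG : G.IsTree) (ω : Boundary G o) (x : V) :
    ∀ᶠ m : ℕ in atTop, height G ω x = (m : ℤ) - G.dist x (ω.1 m) := by
  obtain ⟨σ, hσ, h0, j, k, hjk⟩ := exists_ray_from hG x ω.2.1
  have key : ∀ᶠ m : ℕ in atTop, (m : ℤ) - G.dist x (ω.1 m) = (k : ℤ) - j := by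
    filter_upwards [eventually_ge_atTop k] with m hm
    obtain ⟨n, rfl⟩ := Nat.exists_eq_add_of_le' hm
    have := hσ.dist_add 0 (n + j)
    rw [zero_add, h0, hjk] at this
    rw [this]
    push_cast
    ring
  have hlim : height G ω x = (k : ℤ) - j :=
    Tendsto.limUnder_eq (tendsto_const_nhds.congr' (key.mono fun m hm => hm.symm))
  filter_upwards [key] with m hm
  rw [hlim, hm]

/-- The difference of heights of two points, given a common point of their rays. -/
lemma height_sub_of_mem (hG : G.IsTree) {ω : Boundary G o} {x y z : V}
    (hx : ω ∈ cylinder G o x z) (hy : ω ∈ cylinder G o y z) :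
    height G ω y - height G ω x = (G.dist x z : ℤ) - G.dist y z := by
  rw [mem_cylinder_iff_eventually hG] at hx hy
  obtain ⟨m, h1, h2, h3, h4⟩ := (hx.and (hy.and
    ((height_eventually hG ω x).and (height_eventually hG ω y)))).exists
  rw [h3, h4]
  omega

/-- The median `c` of `x`, `y` and a far point of `ω` is where `[x, ω)` leaves `[x, y]`, and `j =
d(x, c)`. -/
lemma exists_height_sub (hG : G.IsTree) (ω : Boundary G o) (x y : V) :
    ∃ j ≤ G.dist x y, height G ω y - height G ω x = 2 * (j : ℤ) - G.dist x y := by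
  obtain ⟨m, h3, h4⟩ := ((height_eventually hG ω x).and (height_eventually hG ω y)).exists
  obtain ⟨c, h5, h6, h7⟩ := exists_median hG x y (ω.1 m)
  have := G.dist_comm (u := y) (v := c)
  exact ⟨G.dist x c, by omega, by omega⟩

/-- The cylinder of a point of the geodesic `[x, y]` is a superlevel set of the difference of
heights. -/
lemma mem_cylinder_iff_height (hG : G.IsTree) {x y v : V}
    (hv : G.dist x y = G.dist x v + G.dist v y) (ω : Boundary G o) :
    ω ∈ cylinder G o x v ↔
      2 * (G.dist x v : ℤ) - G.dist x y ≤ height G ω y - height G ω x := by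
  rw [mem_cylinder_iff_eventually hG]
  constructor
  · intro h
    obtain ⟨m, h2, h3, h4⟩ := (h.and
      ((height_eventually hG ω x).and (height_eventually hG ω y))).exists
    have := hG.connected.dist_triangle (u := y) (v := v) (w := ω.1 m)
    have := G.dist_comm (u := y) (v := v)
    omega
  · intro h
    filter_upwards [height_eventually hG ω x, height_eventually hG ω y] with m h3 h4
    obtain ⟨c, h5, h6, h7⟩ := exists_median hG x y (ω.1 m)
    have e := G.dist_comm (u := y) (v := c)
    obtain ⟨h8, h9⟩ := between_order hG hv h5 (by omega)
    have := hG.connected.dist_triangle (u := x) (v := v) (w := ω.1 m)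
    have := hG.connected.dist_triangle (u := v) (v := c) (w := ω.1 m)
    omega

lemma cylinder_subset_of_dist_le (hG : G.IsTree) {x z z' : V} {ω : Boundary G o}
    (h : ω ∈ cylinder G o x z) (h' : ω ∈ cylinder G o x z') (hd : G.dist x z ≤ G.dist x z') :
    cylinder G o x z' ⊆ cylinder G o x z := by
  intro ω' hω'
  rw [mem_cylinder_iff_eventually hG] at h h' hω' ⊢
  obtain ⟨m, h1, h2⟩ := (h.and h').exists
  obtain ⟨h3, -⟩ := between_order hG h1 h2 hd
  filter_upwards [hω'] with k hk
  have := hG.connected.dist_triangle (u := x) (v := z) (w := ω'.1 k)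
  have := hG.connected.dist_triangle (u := z) (v := z') (w := ω'.1 k)
  omega

lemma eq_of_mem_cylinder (hG : G.IsTree) {x z z' : V} {ω : Boundary G o}
    (h : ω ∈ cylinder G o x z) (h' : ω ∈ cylinder G o x z') (hd : G.dist x z = G.dist x z') :
    z = z' := by
  rw [mem_cylinder_iff_eventually hG] at h h'
  obtain ⟨m, h1, h2⟩ := (h.and h').exists
  exact between_unique hG h1 h2 hd

/-- The rays from `x` and `y` to `ω` meet at the median `c`, which lies at distance at most `d(x, y)
< d(x, z)` from `x`. So `z` can only be met after `c`, on the common part of both rays. -/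
lemma cylinder_change_base (hG : G.IsTree) {x y z : V} (h : G.dist x y < G.dist x z) :
    cylinder G o x z = cylinder G o y z := by
  ext ω
  simp only [mem_cylinder_iff_eventually hG]
  constructor
  · intro h1
    filter_upwards [h1] with m hm
    obtain ⟨c, h5, h6, h7⟩ := exists_median hG x y (ω.1 m)
    obtain ⟨h8, h9⟩ := between_order hG h6 hm (by omega)
    have := hG.connected.dist_triangle (u := y) (v := c) (w := z)
    have := hG.connected.dist_triangle (u := y) (v := z) (w := ω.1 m)
    omega
  · intro h1
    filter_upwards [h1] with m hm
    obtain ⟨c, h5, h6, h7⟩ := exists_median hG x y (ω.1 m)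
    have e := G.dist_comm (u := y) (v := c)
    rcases le_total (G.dist y c) (G.dist y z) with h8 | h8
    · obtain ⟨h9, h10⟩ := between_order hG h7 hm h8
      have := hG.connected.dist_triangle (u := x) (v := c) (w := z)
      have := hG.connected.dist_triangle (u := x) (v := z) (w := ω.1 m)
      omega
    · obtain ⟨h9, h10⟩ := between_order hG hm h7 h8
      have := hG.connected.dist_triangle (u := x) (v := c) (w := z)
      have := G.dist_comm (u := z) (v := c)
      omega

lemma exists_mem_cylinder (hG : G.IsTree) (ω : Boundary G o) (x : V) (n : ℕ) :
    ∃ z, G.dist x z = n ∧ ω ∈ cylinder G o x z := by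
  obtain ⟨σ, hσ, h0, hm⟩ := exists_ray_from hG x ω.2.1
  refine ⟨σ n, ?_, σ, ⟨hσ, h0, hm⟩, n, rfl⟩
  simpa [h0] using hσ.dist_add 0 n

/-- The cylinders based at `x` form a basis of the topology. -/
lemma exists_cylinder_subset (hG : G.IsTree) {a b : V} {ω : Boundary G o}
    (h : ω ∈ cylinder G o a b) (x : V) (n : ℕ) :
    ∃ z, n ≤ G.dist x z ∧ ω ∈ cylinder G o x z ∧ cylinder G o x z ⊆ cylinder G o a b := by
  obtain ⟨z, hz, hωz⟩ := exists_mem_cylinder hG ω x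
    (n + G.dist x a + G.dist a b + G.dist x a + 1)
  refine ⟨z, by omega, hωz, ?_⟩
  have e := cylinder_change_base (o := o) hG (show G.dist x a < G.dist x z by omega)
  rw [e] at hωz ⊢
  refine cylinder_subset_of_dist_le hG h hωz ?_
  have := hG.connected.dist_triangle (u := x) (v := a) (w := z)
  omega

lemma truncCylinder_eq (hG : G.IsTree) {x z : V} {ω : Boundary G o} {n : ℕ}
    (hz : G.dist x z = n) (h : ω ∈ cylinder G o x z) :
    truncCylinder G n x ω = cylinder G o x z := by
  ext ω'
  constructor
  · rintro ⟨y, h1, h2, h3⟩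
    rwa [eq_of_mem_cylinder hG h h2 (by omega)]
  · exact fun h' => ⟨z, hz, h, h'⟩

/-- Two boundary points whose rays from `x` both follow `[x, y]` for `n` steps are in the same
cylinder of order `n`. -/
lemma truncCylinder_eq_of_height (hG : G.IsTree) {x y : V} {ω ω' : Boundary G o} {n : ℕ}
    (hn : n ≤ G.dist x y) (h : 2 * (n : ℤ) - G.dist x y ≤ height G ω y - height G ω x)
    (h' : 2 * (n : ℤ) - G.dist x y ≤ height G ω' y - height G ω' x) :
    truncCylinder G n x ω = truncCylinder G n x ω' := by
  obtain ⟨v, hv, hb⟩ := exists_between hG x y hn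
  rw [truncCylinder_eq hG hv ((mem_cylinder_iff_height hG hb ω).2 (by rwa [hv])),
    truncCylinder_eq hG hv ((mem_cylinder_iff_height hG hb ω').2 (by rwa [hv]))]

end Geometry

/-! ### The boundary and its measures -/

section BoundaryMeasure

variable {V : Type*} {G : SimpleGraph V} {q : ℕ} {o : V}

lemma isOpen_cylinder (x y : V) : IsOpen (cylinder G o x y) :=
  TopologicalSpace.isOpen_generateFrom_of_mem ⟨x, y, rfl⟩

lemma measurableSet_cylinder (x y : V) : MeasurableSet (cylinder G o x y) :=
  (isOpen_cylinder x y).measurableSet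

lemma countable_cylinders (hG : IsHomogeneousTree G q) :
    {U | ∃ x y : V, U = cylinder G o x y}.Countable := by
  have := countable_vertices hG o
  refine (Set.countable_range fun p : V × V => cylinder G o p.1 p.2).mono ?_
  rintro U ⟨a, b, rfl⟩
  exact ⟨(a, b), rfl⟩

lemma secondCountable_boundary (hG : IsHomogeneousTree G q) :
    SecondCountableTopology (Boundary G o) :=
  SecondCountableTopology.mk ⟨_, countable_cylinders hG, rfl⟩

variable (G q o) in
lemma nonempty_boundary [hG : IsHomogeneousTree G q] : Nonempty (Boundary G o) := by
  let ξ : (v : V) → children G o v := fun v => ⟨_, (children_nonempty hG o v).some_mem⟩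
  exact ⟨⟨walkOut o ξ, walkOut_isHalfGeodesic hG.isTree o ξ, rfl⟩⟩

lemma isOpen_walkOut [∀ v, TopologicalSpace (children G o v)]
    [∀ v, DiscreteTopology (children G o v)] (n : ℕ) (w : V) :
    IsOpen {ξ : (v : V) → children G o v | walkOut o ξ n = w} := by
  induction n generalizing w with
  | zero =>
    simp only [walkOut]
    exact isOpen_const
  | succ n ih =>
    have : {ξ : (v : V) → children G o v | walkOut o ξ (n + 1) = w} =
        ⋃ v : V, {ξ | walkOut o ξ n = v} ∩ (fun ξ => ξ v) ⁻¹' {c | c.1 = w} := by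
      ext ξ
      simp [walkOut]
    rw [this]
    exact isOpen_iUnion fun v => (ih v).inter ((isOpen_discrete _).preimage (continuous_apply v))

variable (G q o) in
-- The boundary is a continuous image of a product of finite discrete spaces, namely of all choices
-- of one child at each vertex.
lemma compactSpace_boundary [hG : IsHomogeneousTree G q] : CompactSpace (Boundary G o) := by
  classical
  have hT := hG.isTree
  let _ : ∀ v, TopologicalSpace (children G o v) := fun v => ⊥
  have _ : ∀ v, DiscreteTopology (children G o v) := fun v => ⟨rfl⟩
  have _ : ∀ v, Finite (children G o v) := fun v => children_finite hG o v
  let T : ((v : V) → children G o v) → Boundary G o :=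
    fun ξ => ⟨walkOut o ξ, walkOut_isHalfGeodesic hT o ξ, rfl⟩
  have hmem : ∀ (ξ : (v : V) → children G o v) (z : V),
      T ξ ∈ cylinder G o o z ↔ walkOut o ξ (G.dist o z) = z := by
    intro ξ z
    have h1 : T ξ ∈ cylinder G o o (walkOut o ξ (G.dist o z)) :=
      ⟨walkOut o ξ, ⟨walkOut_isHalfGeodesic hT o ξ, rfl, 0, 0, fun _ => rfl⟩, _, rfl⟩
    constructor
    · exact fun h => eq_of_mem_cylinder hT h1 h (dist_walkOut _ _ _)
    · intro h
      rwa [h] at h1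
  have hcont : Continuous T := by
    refine continuous_generateFrom_iff.2 ?_
    rintro U ⟨a, b, rfl⟩
    refine isOpen_iff_mem_nhds.2 fun (ξ : (v : V) → children G o v) hξ => ?_
    obtain ⟨z, -, h1, h2⟩ := exists_cylinder_subset hT hξ o 0
    refine Filter.mem_of_superset
      ((isOpen_walkOut (G := G) (o := o) (G.dist o z) z).mem_nhds ((hmem ξ z).1 h1)) ?_
    exact fun ξ' h' => h2 ((hmem ξ' z).2 h')
  have hsurj : Function.Surjective T := by
    intro ω
    have hd : ∀ n, G.dist o (ω.1 n) = n := fun n => by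
      simpa [ω.2.2] using ω.2.1.dist_add 0 n
    -- The choice follows `ω` at the vertices of `ω` and is arbitrary elsewhere.
    let ξ : (v : V) → children G o v := fun v =>
      if h : ω.1 (G.dist o v + 1) ∈ children G o v then ⟨_, h⟩
      else ⟨_, (children_nonempty hG o v).some_mem⟩
    refine ⟨ξ, Subtype.ext (funext fun n => ?_)⟩
    change walkOut o ξ n = ω.1 n
    induction n with
    | zero => exact ω.2.2.symm
    | succ n ih =>
      have hch : ω.1 (G.dist o (ω.1 n) + 1) ∈ children G o (ω.1 n) := by
        rw [hd]
        exact ⟨ω.2.1.adj n, by rw [hd, hd]⟩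
      rw [walkOut, ih]
      change ((if h : ω.1 (G.dist o (ω.1 n) + 1) ∈ children G o (ω.1 n) then
        (⟨_, h⟩ : children G o (ω.1 n)) else
          ⟨_, (children_nonempty hG o (ω.1 n)).some_mem⟩) : children G o (ω.1 n)).1 = _
      rw [dif_pos hch]
      exact congrArg (fun k => ω.1 (k + 1)) (hd n)
  exact ⟨by rw [← hsurj.range_eq]; exact isCompact_range hcont⟩

lemma two_le_real (hG : IsHomogeneousTree G q) : (2 : ℝ) ≤ q := by exact_mod_cast hG.two_le

/-- A level is the cylinder of the `j`-th point of `[x, y]` minus that of the next point, if there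
is one; values other than `2j - d(x, y)` do not occur. -/
lemma measurableSet_level (hG : IsHomogeneousTree G q) (x y : V) (n : ℤ) :
    MeasurableSet {ω : Boundary G o | height G ω y - height G ω x = n} := by
  have hT := hG.isTree
  by_cases hj : ∃ j ≤ G.dist x y, n = 2 * (j : ℤ) - G.dist x y
  · obtain ⟨j, hj, rfl⟩ := hj
    obtain ⟨v, hv, hb⟩ := exists_between hT x y hj
    rcases hj.lt_or_eq with hj' | hj'
    · obtain ⟨w, hw, hb'⟩ := exists_between hT x y (n := j + 1) (by omega)
      convert (measurableSet_cylinder (G := G) (o := o) x v).diff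
        (measurableSet_cylinder (G := G) (o := o) x w) using 1
      ext ω
      rw [Set.mem_sdiff, mem_cylinder_iff_height hT hb, mem_cylinder_iff_height hT hb', hv, hw]
      obtain ⟨i, -, hi⟩ := exists_height_sub hT ω x y
      simp only [Set.mem_ofPred_eq, hi]
      push_cast
      omega
    · convert (measurableSet_cylinder (G := G) (o := o) x v) using 1
      ext ω
      rw [mem_cylinder_iff_height hT hb, hv]
      obtain ⟨i, hi', hi⟩ := exists_height_sub hT ω x y
      simp only [Set.mem_ofPred_eq, hi]
      omega
  · convert MeasurableSet.empty using 1
    ext ω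
    simp only [Set.mem_ofPred_eq, Set.mem_empty_iff_false, iff_false]
    rintro rfl
    obtain ⟨j, h1, h2⟩ := exists_height_sub hT ω x y
    exact hj ⟨j, h1, h2⟩

lemma measurable_height_sub (hG : IsHomogeneousTree G q) (x y : V) :
    Measurable fun ω : Boundary G o => height G ω y - height G ω x :=
  measurable_to_countable' fun n => measurableSet_level hG x y n

variable [hG : IsHomogeneousTree G q]

lemma boundaryMeasure_spec (o x : V) :
    IsBoundaryMeasure G q o x (boundaryMeasure G q o x) :=
  (exists_boundaryMeasure hG o x).choose_spec

instance (x : V) : IsProbabilityMeasure (boundaryMeasure G q o x) :=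
  (boundaryMeasure_spec o x).1

lemma measureReal_cylinder {x z : V} {n : ℕ} (h : G.dist x z = n + 1) :
    (boundaryMeasure G q o x).real (cylinder G o x z) = (((q : ℝ) + 1) * (q : ℝ) ^ n)⁻¹ := by
  rw [Measure.real, (boundaryMeasure_spec o x).2 (n + 1) z (by omega) h]
  simp [ENNReal.toReal_mul, ENNReal.toReal_inv, ENNReal.toReal_add]

/-- The level lies in the cylinder of the `j`-th point of `[x, y]`, of mass `1 / ((q+1) q^(j-1))`
when `j ≥ 1`; for `j = 0` the bound is 1. -/
lemma measureReal_level_le (x y : V) {j : ℕ} (hj : j ≤ G.dist x y) :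
    (boundaryMeasure G q o x).real
      {ω | height G ω y - height G ω x = 2 * (j : ℤ) - G.dist x y} ≤ ((q : ℝ) ^ j)⁻¹ := by
  have hq := two_le_real hG
  obtain ⟨v, hv, hb⟩ := exists_between hG.isTree x y hj
  rcases j with _ | j
  · simp
  · have h1 : (boundaryMeasure G q o x).real (cylinder G o x v) ≤ ((q : ℝ) ^ (j + 1))⁻¹ := by
      rw [measureReal_cylinder hv, pow_succ']
      gcongr
      linarith
    refine (measureReal_mono fun ω hω => ?_).trans h1
    rw [mem_cylinder_iff_height hG.isTree hb, hv]
    exact (show _ = _ from hω).ge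

/-- Exactness is needed here: with masses strictly proportional to `q^{-j}`, the sum over the inner
levels telescopes. The two end levels `j = 0` and `j = d(x, y)` carry a different constant. -/
lemma measureReal_level (x y : V) {j : ℕ} (hj0 : 1 ≤ j) (hj : j < G.dist x y) :
    (boundaryMeasure G q o x).real
      {ω | height G ω y - height G ω x = 2 * (j : ℤ) - G.dist x y} =
        ((q : ℝ) - 1) / (q + 1) * ((q : ℝ) ^ j)⁻¹ := by
  have hT := hG.isTree
  have hq := two_le_real hG
  obtain ⟨i, rfl⟩ := Nat.exists_eq_add_of_le' hj0
  obtain ⟨v, hv, hb⟩ := exists_between hT x y hj.le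
  obtain ⟨w, hw, hb'⟩ := exists_between hT x y (n := i + 1 + 1) (by omega)
  have h1 : {ω : Boundary G o | height G ω y - height G ω x = 2 * ((i + 1 : ℕ) : ℤ) - G.dist x y}
      = cylinder G o x v \ cylinder G o x w := by
    ext ω
    rw [Set.mem_sdiff, mem_cylinder_iff_height hT hb, mem_cylinder_iff_height hT hb', hv, hw]
    obtain ⟨i, -, hi⟩ := exists_height_sub hT ω x y
    simp only [Set.mem_ofPred_eq, hi]
    push_cast
    omega
  have h2 : cylinder G o x w ⊆ cylinder G o x v := by
    intro ω
    rw [mem_cylinder_iff_height hT hb, mem_cylinder_iff_height hT hb', hv, hw]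
    push_cast
    omega
  rw [h1, measureReal_sdiff h2 (measurableSet_cylinder x w), measureReal_cylinder hv,
    measureReal_cylinder hw]
  field_simp
  ring

variable (q) in
/-- The density of `ν_y` with respect to `ν_x`. -/
lemma boundaryMeasure_eq_withDensity (x y : V) :
    boundaryMeasure G q o y = (boundaryMeasure G q o x).withDensity
      fun ω => ENNReal.ofReal ((q : ℝ) ^ (height G ω y - height G ω x)) := by
  have hT := hG.isTree
  have hq := two_le_real hG
  have _ := countable_vertices hG o
  have _ := secondCountable_boundary (o := o) hG
  -- Cylinders that start beyond distance `d(x, y)` still generate the Borel sets. They are the same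
  -- seen from `x` and from `y`, and the density is constant on each of them, so there the identity
  -- is a ratio of cylinder masses.
  let S : Set (Set (Boundary G o)) :=
    {U | ∃ z, G.dist x y < G.dist x z ∧ U = cylinder G o x z}
  have hScount : S.Countable := by
    refine (countable_cylinders (o := o) hG).mono ?_
    rintro U ⟨z, -, rfl⟩
    exact ⟨x, z, rfl⟩
  have hgen : (borel (Boundary G o)) = MeasurableSpace.generateFrom S := by
    refine le_antisymm ?_ ?_
    · rw [borel_eq_generateFrom_of_subbasis (s := {U | ∃ x y : V, U = cylinder G o x y}) rfl]
      refine MeasurableSpace.generateFrom_le ?_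
      rintro U ⟨a, b, rfl⟩
      have : cylinder G o a b = ⋃ z ∈ {z | G.dist x y < G.dist x z ∧
          cylinder G o x z ⊆ cylinder G o a b}, cylinder G o x z := by
        refine Set.Subset.antisymm (fun ω hω => ?_) (Set.iUnion₂_subset fun z hz => hz.2)
        obtain ⟨z, h1, h2, h3⟩ := exists_cylinder_subset hT hω x (G.dist x y + 1)
        exact Set.mem_biUnion (show _ ∧ _ from ⟨h1, h3⟩) h2
      rw [this]
      exact MeasurableSet.biUnion (Set.to_countable _) fun z hz =>
        MeasurableSpace.measurableSet_generateFrom ⟨z, hz.1, rfl⟩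
    · refine MeasurableSpace.generateFrom_le ?_
      rintro U ⟨z, -, rfl⟩
      exact measurableSet_cylinder x z
  refine Measure.ext_of_generateFrom_of_cover_subset (S := S) (T := S) hgen ?_ subset_rfl hScount
    ?_ ?_ ?_
  · rintro _ ⟨z, hz, rfl⟩ _ ⟨z', hz', rfl⟩ ⟨ω, h, h'⟩
    rcases le_total (G.dist x z) (G.dist x z') with hd | hd
    · exact ⟨z', hz', Set.inter_eq_right.2 (cylinder_subset_of_dist_le hT h h' hd)⟩
    · exact ⟨z, hz, Set.inter_eq_left.2 (cylinder_subset_of_dist_le hT h' h hd)⟩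
  · refine Set.eq_univ_of_forall fun ω => ?_
    obtain ⟨z, hz, hω⟩ := exists_mem_cylinder hT ω x (G.dist x y + 1)
    exact ⟨_, ⟨z, by omega, rfl⟩, hω⟩
  · exact fun _ _ => measure_ne_top _ _
  · rintro _ ⟨z, hz, rfl⟩
    obtain ⟨m, hm⟩ : ∃ m, G.dist x z = m + 1 := Nat.exists_eq_add_of_le' (by omega)
    have ht := hT.connected.dist_triangle (u := x) (v := y) (w := z)
    obtain ⟨n, hn⟩ : ∃ n, G.dist y z = n + 1 := Nat.exists_eq_add_of_le' (by omega)
    rw [withDensity_apply _ (measurableSet_cylinder x z),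
      setLIntegral_congr_fun (g := fun _ => ENNReal.ofReal ((q : ℝ) ^ ((m : ℤ) - n)))
        (measurableSet_cylinder x z)]
    · rw [setLIntegral_const, ← ofReal_measureReal, ← ofReal_measureReal, measureReal_cylinder hm,
        cylinder_change_base hT hz, measureReal_cylinder hn, ← ENNReal.ofReal_mul (by positivity),
        zpow_sub₀ (by positivity)]
      congr 1
      simp only [zpow_natCast]
      field_simp
    · intro ω hω
      have h1 := height_sub_of_mem hT hω (by rwa [← cylinder_change_base hT hz])
      simp only [h1, hm, hn]
      congr 2
      push_cast
      ring

end BoundaryMeasure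

/-! ### Oscillatory integrals -/

section Oscillatory

/-- Smooth functions on `[0, T]` all of whose derivatives vanish at both end points. -/
structure IsFlat (T : ℝ) (f : ℝ → ℂ) : Prop where
  smooth : ContDiffOn ℝ ((⊤ : ℕ∞) : WithTop ℕ∞) f (Set.Icc 0 T)
  left : ∀ k : ℕ, iteratedDerivWithin k f (Set.Icc 0 T) 0 = 0
  right : ∀ k : ℕ, iteratedDerivWithin k f (Set.Icc 0 T) T = 0

variable {T : ℝ} {f : ℝ → ℂ}

lemma IsFlat.derivWithin (hT : 0 < T) (hf : IsFlat T f) :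
    IsFlat T (derivWithin f (Set.Icc 0 T)) where
  smooth := hf.smooth.derivWithin (uniqueDiffOn_Icc hT) (by simp)
  left k := by rw [← iteratedDerivWithin_succ']; exact hf.left _
  right k := by rw [← iteratedDerivWithin_succ']; exact hf.right _

lemma IsFlat.apply_zero (hf : IsFlat T f) : f 0 = 0 := by simpa using hf.left 0

lemma IsFlat.apply_right (hf : IsFlat T f) : f T = 0 := by simpa using hf.right 0

/-- There is no boundary term because `f` vanishes at both ends. The smooth weight `g` is kept apart
from `f`, so that later constants depend on `g` while the estimates involve only derivatives of `f`.
-/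
lemma integral_exp_mul_eq (hT : 0 < T) (hf : IsFlat T f) {g : ℝ → ℂ}
    (hg : ContDiff ℝ ((⊤ : ℕ∞) : WithTop ℕ∞) g) {n : ℝ} (hn : n ≠ 0) :
    ∫ s in (0 : ℝ)..T, Complex.exp (Complex.I * (n * s : ℝ)) * (f s * g s) =
      -(Complex.I * n)⁻¹ *
        ((∫ s in (0 : ℝ)..T, Complex.exp (Complex.I * (n * s : ℝ)) *
          (derivWithin f (Set.Icc 0 T) s * g s)) +
        ∫ s in (0 : ℝ)..T, Complex.exp (Complex.I * (n * s : ℝ)) * (f s * deriv g s)) := by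
  have hne : Complex.I * (n : ℂ) ≠ 0 := by simpa using hn
  have hcf : ContinuousOn f (Set.uIcc 0 T) := by
    rw [Set.uIcc_of_le hT.le]; exact hf.smooth.continuousOn
  have hcf' : ContinuousOn (derivWithin f (Set.Icc 0 T)) (Set.uIcc 0 T) := by
    rw [Set.uIcc_of_le hT.le]; exact (hf.derivWithin hT).smooth.continuousOn
  have hcg : Continuous g := hg.continuous
  have hcg' : Continuous (deriv g) := (hg.continuous_deriv (by simp))
  have hE : Continuous fun s : ℝ => Complex.exp (Complex.I * (n * s : ℝ)) := by fun_prop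
  have hc1 : ContinuousOn (fun s => derivWithin f (Set.Icc 0 T) s * g s) (Set.uIcc 0 T) :=
    hcf'.mul hcg.continuousOn
  have hc2 : ContinuousOn (fun s => f s * deriv g s) (Set.uIcc 0 T) := hcf.mul hcg'.continuousOn
  have hparts := intervalIntegral.integral_mul_deriv_eq_deriv_mul_of_hasDerivAt
    (a := 0) (b := T) (u := fun s => f s * g s)
    (v := fun s : ℝ => (Complex.I * n)⁻¹ * Complex.exp (Complex.I * (n * s : ℝ)))
    (u' := fun s => derivWithin f (Set.Icc 0 T) s * g s + f s * deriv g s)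
    (v' := fun s : ℝ => Complex.exp (Complex.I * (n * s : ℝ)))
    (hcf.mul hcg.continuousOn) (continuous_const.mul hE).continuousOn
    (fun s hs => by
      rw [min_eq_left hT.le, max_eq_right hT.le] at hs
      have hnb : Set.Icc 0 T ∈ 𝓝 s := Icc_mem_nhds hs.1 hs.2
      have h1 : HasDerivAt f (derivWithin f (Set.Icc 0 T) s) s :=
        ((hf.smooth.differentiableOn (by simp) s ⟨hs.1.le, hs.2.le⟩).hasDerivWithinAt).hasDerivAt
          hnb
      exact h1.mul (hg.differentiable (by simp) s).hasDerivAt)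
    (fun s hs => by
      have h1 : HasDerivAt (fun s : ℝ => Complex.I * ((n * s : ℝ) : ℂ)) (Complex.I * n) s := by
        have := (((hasDerivAt_id s).const_mul n).ofReal_comp).const_mul Complex.I
        simpa using this
      have h2 := (h1.cexp).const_mul (Complex.I * (n : ℂ))⁻¹
      convert h2 using 1
      rw [mul_comm (Complex.exp _), inv_mul_cancel_left₀ hne])
    ((hc1.add hc2).intervalIntegrable) (hE.intervalIntegrable _ _)
  have hcomm : ∀ F : ℝ → ℂ, (∫ s in (0 : ℝ)..T, Complex.exp (Complex.I * (n * s : ℝ)) * F s)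
      = ∫ s in (0 : ℝ)..T, F s * Complex.exp (Complex.I * (n * s : ℝ)) := fun F => by
    congr 1; ext s; ring
  have hadd : (∫ s in (0 : ℝ)..T, (Complex.exp (Complex.I * (n * s : ℝ)) *
      (derivWithin f (Set.Icc 0 T) s * g s) +
        Complex.exp (Complex.I * (n * s : ℝ)) * (f s * deriv g s))) = _ :=
    intervalIntegral.integral_add (hE.continuousOn.mul hc1).intervalIntegrable
      (hE.continuousOn.mul hc2).intervalIntegrable
  rw [← hadd, hcomm, hparts, hf.apply_zero, hf.apply_right, ← intervalIntegral.integral_const_mul]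
  simp only [zero_mul, sub_zero, zero_sub]
  rw [← intervalIntegral.integral_neg]
  congr 1
  ext s
  ring

/-- Repeated integration by parts. -/
lemma exists_oscillatory_bound (hT : 0 < T) (M : ℕ) : ∀ g : ℝ → ℂ,
    ContDiff ℝ ((⊤ : ℕ∞) : WithTop ℕ∞) g → ∃ C : ℝ, 0 ≤ C ∧ ∀ (f : ℝ → ℂ) (B n : ℝ),
      IsFlat T f →
      (∀ k ≤ M, ∀ s ∈ Set.Icc 0 T, ‖iteratedDerivWithin k f (Set.Icc 0 T) s‖ ≤ B) →
      |n| ^ M * ‖∫ s in (0 : ℝ)..T, Complex.exp (Complex.I * (n * s : ℝ)) * (f s * g s)‖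
        ≤ C * B := by
  induction M with
  | zero =>
    intro g hg
    obtain ⟨D, hD⟩ := isCompact_Icc.exists_bound_of_continuousOn
      (s := Set.Icc 0 T) hg.continuous.continuousOn
    have hD0 : 0 ≤ D := (norm_nonneg _).trans (hD 0 ⟨le_rfl, hT.le⟩)
    refine ⟨D * T, by positivity, fun f B n hf hB => ?_⟩
    rw [pow_zero, one_mul]
    refine (intervalIntegral.norm_integral_le_of_norm_le_const (C := B * D) fun s hs => ?_).trans
      (le_of_eq ?_)
    · rw [Set.uIoc_of_le hT.le] at hs
      have hs' : s ∈ Set.Icc 0 T := ⟨hs.1.le, hs.2⟩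
      rw [norm_mul, Complex.norm_exp_I_mul_ofReal, one_mul, norm_mul]
      have := hB 0 le_rfl s hs'
      rw [iteratedDerivWithin_zero] at this
      exact mul_le_mul this (hD s hs') (norm_nonneg _) ((norm_nonneg _).trans this)
    · rw [sub_zero, abs_of_pos hT]; ring
  | succ M ih =>
    intro g hg
    -- The derivative falls either on `f` or on `g`; this is why the induction is over all weights
    -- `g` at once.
    obtain ⟨C₁, h1, hC₁⟩ := ih g hg
    obtain ⟨C₂, h2, hC₂⟩ := ih (deriv g) (ContDiff.deriv' (by simpa using hg))
    refine ⟨C₁ + C₂, by positivity, fun f B n hf hB => ?_⟩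
    have hB0 : 0 ≤ B := (norm_nonneg _).trans (hB 0 (by omega) 0 ⟨le_rfl, hT.le⟩)
    rcases eq_or_ne n 0 with rfl | hn
    · simp only [abs_zero, ne_eq, Nat.add_eq_zero_iff, one_ne_zero, and_false, not_false_eq_true,
        zero_pow, zero_mul]
      positivity
    · have k1 := hC₁ (derivWithin f (Set.Icc 0 T)) B n (hf.derivWithin hT) fun k hk s hs => by
        rw [← iteratedDerivWithin_succ']; exact hB _ (by omega) s hs
      have k2 := hC₂ f B n hf fun k hk s hs => hB k (by omega) s hs
      rw [integral_exp_mul_eq hT hf hg hn, norm_mul, norm_neg, norm_inv, norm_mul, Complex.norm_I,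
        one_mul, Complex.norm_real, Real.norm_eq_abs, pow_succ, mul_assoc,
        mul_inv_cancel_left₀ (abs_ne_zero.2 hn), add_mul]
      refine (mul_le_mul_of_nonneg_left (norm_add_le _ _) (by positivity)).trans ?_
      rw [mul_add]
      exact add_le_add k1 k2

end Oscillatory

/-! ### The Plancherel density -/

section Plancherel

variable {q : ℕ}

lemma tau_pos (hq : 2 ≤ q) : 0 < tau q :=
  div_pos Real.pi_pos (Real.log_pos (by exact_mod_cast hq))

lemma natCast_cpow (hq : 2 ≤ q) (z : ℂ) : (q : ℂ) ^ z = Complex.exp (Real.log q * z) := by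
  have : (q : ℂ) ≠ 0 := by simp; omega
  rw [Complex.cpow_def_of_ne_zero this, ← Complex.natCast_log]

/-- The factor of the Plancherel density which remains smooth after division by
`q ^ (2 i s) - 1`. -/
noncomputable def plancherelFactor (q : ℕ) (s : ℝ) : ℂ :=
  ((Real.log q * (q + 1) / (4 * Real.pi) * (4 * Real.sin (Real.log q * s)) /
    (q + (q : ℝ)⁻¹ - 2 * Real.cos (2 * Real.log q * s)) : ℝ) : ℂ) *
      (Complex.exp (Complex.I * (-(Real.log q) * s : ℝ)) / (2 * Complex.I))

lemma plancherel_denominator_pos (hq : 2 ≤ q) (t : ℝ) :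
    0 < q + (q : ℝ)⁻¹ - 2 * Real.cos t := by
  have h2 : (2 : ℝ) ≤ q := by exact_mod_cast hq
  have : 0 < (q : ℝ)⁻¹ := by positivity
  linarith [Real.cos_le_one t]

lemma contDiff_plancherelFactor (hq : 2 ≤ q) :
    ContDiff ℝ ((⊤ : ℕ∞) : WithTop ℕ∞) (plancherelFactor q) := by
  unfold plancherelFactor
  refine ContDiff.mul (Complex.ofRealCLM.contDiff.comp (ContDiff.div ?_ ?_ fun s =>
    (plancherel_denominator_pos hq _).ne')) (ContDiff.div_const ?_ _)
  · fun_prop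
  · fun_prop
  · exact ContDiff.cexp (contDiff_const.mul
      (Complex.ofRealCLM.contDiff.comp (contDiff_const.mul contDiff_id)))

/-- This is `|2 sinh(u + iv)|²`. The numerator of `𝐜(s)` is the case `u = (log q)/2`, its
denominator the case `u = 0`, both with `v = s log q`. -/
lemma normSq_exp_sub_exp_neg (u v : ℝ) :
    ‖Complex.exp (u + v * Complex.I) - Complex.exp (-(u + v * Complex.I))‖ ^ 2 =
      Real.exp u ^ 2 + (Real.exp u)⁻¹ ^ 2 - 2 * Real.cos (2 * v) := by
  have h1 : Complex.exp (u + v * Complex.I) =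
      (Real.exp u * Real.cos v : ℝ) + (Real.exp u * Real.sin v : ℝ) * Complex.I := by
    rw [Complex.exp_add, Complex.exp_mul_I]; push_cast; ring
  have h2 : Complex.exp (-(u + v * Complex.I)) =
      ((Real.exp u)⁻¹ * Real.cos v : ℝ) + (-(Real.exp u)⁻¹ * Real.sin v : ℝ) * Complex.I := by
    rw [show -((u : ℂ) + v * Complex.I) = ((-u : ℝ) : ℂ) + ((-v : ℝ) : ℂ) * Complex.I by
      push_cast; ring, Complex.exp_add, Complex.exp_mul_I, ← Real.exp_neg]
    simp only [← Complex.ofReal_cos, ← Complex.ofReal_sin, Real.cos_neg, Real.sin_neg]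
    push_cast; ring
  have h3 : Real.exp u * (Real.exp u)⁻¹ = 1 := mul_inv_cancel₀ (Real.exp_pos u).ne'
  rw [h1, h2, ← Complex.normSq_eq_norm_sq, Complex.normSq_apply]
  simp only [Complex.sub_re, Complex.add_re, Complex.ofReal_re, Complex.mul_re, Complex.I_re,
    Complex.ofReal_im, Complex.I_im, Complex.sub_im, Complex.add_im, Complex.mul_im]
  rw [Real.cos_two_mul']
  linear_combination (Real.exp u ^ 2 + (Real.exp u)⁻¹ ^ 2) * Real.sin_sq_add_cos_sq v +
    2 * (Real.sin v ^ 2 - Real.cos v ^ 2) * h3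

/-- No zero of the sine has to be excluded: at a pole of `𝐜` the convention `1/0 = 0` makes both
sides vanish, in accordance with the limit. -/
lemma plancherelDensity_eq (hq : 2 ≤ q) (s : ℝ) :
    plancherelDensity q s = Real.log q * (q + 1) / (4 * Real.pi) *
      (4 * Real.sin (Real.log q * s) ^ 2) /
        (q + (q : ℝ)⁻¹ - 2 * Real.cos (2 * Real.log q * s)) := by
  have hq0 : (0 : ℝ) < q := by exact_mod_cast (by omega : 0 < q)
  obtain ⟨L, hL⟩ : ∃ L, L = Real.log q := ⟨_, rfl⟩
  rw [← hL]
  have hexp : Real.exp (L / 2) ^ 2 = q := by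
    rw [← Real.exp_nat_mul, hL]
    push_cast
    rw [mul_div_cancel₀ _ (by norm_num), Real.exp_log hq0]
  have h1 : ‖(q : ℂ) ^ (1 / 2 + Complex.I * (s : ℂ)) - (q : ℂ) ^ (-(1 / 2) - Complex.I * (s : ℂ))‖
      ^ 2 = q + (q : ℝ)⁻¹ - 2 * Real.cos (2 * L * s) := by
    have := normSq_exp_sub_exp_neg (L / 2) (L * s)
    rw [inv_pow, hexp, ← mul_assoc] at this
    rw [← this, natCast_cpow hq, natCast_cpow hq, ← hL]
    congr 4 <;> (push_cast; ring)
  have h2 : ‖(q : ℂ) ^ (Complex.I * (s : ℂ)) - (q : ℂ) ^ (-(Complex.I * (s : ℂ)))‖ ^ 2 =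
      4 * Real.sin (L * s) ^ 2 := by
    have := normSq_exp_sub_exp_neg 0 (L * s)
    rw [Real.exp_zero, Real.cos_two_mul'] at this
    rw [natCast_cpow hq, natCast_cpow hq, ← hL]
    have h3 := Real.sin_sq_add_cos_sq (L * s)
    rw [show 4 * Real.sin (L * s) ^ 2 = 1 ^ 2 + 1⁻¹ ^ 2 -
      2 * (Real.cos (L * s) ^ 2 - Real.sin (L * s) ^ 2) by linear_combination 2 * h3, ← this]
    congr 4 <;> (push_cast; ring)
  have h3 : ‖(q : ℂ) ^ (1 / 2 : ℂ)‖ ^ 2 = q := by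
    rw [natCast_cpow hq, Complex.norm_exp, ← hL, ← hexp]
    congr 2
    simp
    ring
  have h4 : ‖(q : ℂ) + 1‖ = q + 1 := by
    rw [show (q : ℂ) + 1 = ((q + 1 : ℝ) : ℂ) by push_cast; ring, Complex.norm_real,
      Real.norm_of_nonneg (by positivity)]
  have h5 := plancherel_denominator_pos hq (2 * L * s)
  rw [plancherelDensity, cFun, norm_mul, norm_div, norm_div, mul_pow, div_pow, div_pow, h1, h2, h3,
    h4, ← hL]
  have hpi := Real.pi_pos
  rw [mul_inv, inv_div, inv_div]
  field_simp

/-- Since `e^{2iv} - 1 = 2i sin(v) e^{iv}`, one of the two sine factors of the density is traded for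
`q^{2is} - 1`. The exponent 2 matches the spacing of the values `2j - d` of the height difference.
-/
lemma plancherelDensity_eq_factor (hq : 2 ≤ q) (s : ℝ) :
    (plancherelDensity q s : ℂ) =
      (Complex.exp (Complex.I * (2 * Real.log q * s : ℝ)) - 1) * plancherelFactor q s := by
  obtain ⟨v, hv⟩ : ∃ v, v = Real.log q * s := ⟨_, rfl⟩
  have h1 : Complex.exp (Complex.I * (2 * Real.log q * s : ℝ)) - 1 =
      2 * Complex.I * (Real.sin v : ℂ) * Complex.exp (Complex.I * (v : ℝ)) := by
    have e1 : Complex.I * (2 * Real.log q * s : ℝ) = Complex.I * (v : ℝ) + Complex.I * (v : ℝ) := by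
      rw [mul_assoc, ← hv]; push_cast; ring
    rw [e1, Complex.exp_add, mul_comm Complex.I, Complex.exp_mul_I, ← Complex.ofReal_sin,
      ← Complex.ofReal_cos]
    have h3 : (Real.sin v : ℂ) ^ 2 + (Real.cos v : ℂ) ^ 2 = 1 := by
      exact_mod_cast Real.sin_sq_add_cos_sq v
    linear_combination h3 - (Real.sin v : ℂ) ^ 2 * Complex.I_sq
  have h2 : Complex.exp (Complex.I * (v : ℝ)) *
      Complex.exp (Complex.I * (-(Real.log q) * s : ℝ)) = 1 := by
    rw [← Complex.exp_add, neg_mul, ← hv, ← mul_add, ← Complex.ofReal_add]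
    simp
  rw [plancherelDensity_eq hq, h1, plancherelFactor, ← hv]
  generalize Complex.exp (Complex.I * (-(Real.log q) * s : ℝ)) = E at h2
  have h3 : ∀ a c : ℝ, ((a * (4 * Real.sin v ^ 2) / c : ℝ) : ℂ) =
      ((a * (4 * Real.sin v) / c : ℝ) : ℂ) * Real.sin v := fun a c => by
    rw [← Complex.ofReal_mul]
    congr 1
    ring
  rw [h3]
  have hI := Complex.I_ne_zero
  field_simp
  rw [mul_assoc _ _ E, h2, mul_one]

lemma contDiff_plancherelDensity (hq : 2 ≤ q) :
    ContDiff ℝ ((⊤ : ℕ∞) : WithTop ℕ∞) fun s => (plancherelDensity q s : ℂ) := by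
  simp only [plancherelDensity_eq_factor hq]
  refine ContDiff.mul (ContDiff.sub (ContDiff.cexp
    (contDiff_const.mul (Complex.ofRealCLM.contDiff.comp (contDiff_const.mul contDiff_id))))
      contDiff_const) (contDiff_plancherelFactor hq)

end Plancherel

/-! ### Estimates of kernels -/

section KernelEstimate

/-- Fourier coefficients with respect to the measure `g(s) ds`. -/
noncomputable def fourierCoeff (q : ℕ) (g : ℝ → ℂ) (n : ℤ) (f : ℝ → ℂ) : ℂ :=
  ∫ s in (0 : ℝ)..tau q, Complex.exp (Complex.I * ((n * Real.log q) * s : ℝ)) * (f s * g s)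

variable {q : ℕ}

/-- The condition `1 + d ≤ 4|n|` holds for all indices to which this is applied: height differences
outside the middle range, and the ends of the telescoped sum, have absolute value at least `d/2`.
The factor `(4 / log q)^M` converts powers of `|n| log q` into powers of `1 + d`. -/
lemma exists_fourierCoeff_bound (hq : 2 ≤ q) (M : ℕ) {g : ℝ → ℂ}
    (hg : ContDiff ℝ ((⊤ : ℕ∞) : WithTop ℕ∞) g) :
    ∃ C : ℝ, 0 ≤ C ∧ ∀ (f : ℝ → ℂ) (B : ℝ) (n : ℤ) (d : ℕ), IsFlat (tau q) f →
      (∀ k ≤ M, ∀ s ∈ Set.Icc 0 (tau q), ‖derivS q k f s‖ ≤ B) → (1 + (d : ℝ)) ≤ 4 * |(n : ℝ)| →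
      ‖fourierCoeff q g n f‖ ≤ C * (B / (1 + (d : ℝ)) ^ M) := by
  obtain ⟨C, hC0, hC⟩ := exists_oscillatory_bound (tau_pos hq) M g hg
  have hL : 0 < Real.log q := Real.log_pos (by exact_mod_cast hq)
  refine ⟨C * (4 / Real.log q) ^ M, by positivity, fun f B n d hf hB hn => ?_⟩
  have h1 := hC f B (n * Real.log q) hf hB
  rw [abs_mul, abs_of_pos hL] at h1
  have h2 : ((1 + (d : ℝ)) / 4 * Real.log q) ^ M ≤ (|(n : ℝ)| * Real.log q) ^ M := by
    gcongr
    linarith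
  have h3 : ((1 + (d : ℝ)) / 4 * Real.log q) ^ M * ‖fourierCoeff q g n f‖ ≤ C * B :=
    (mul_le_mul_of_nonneg_right h2 (norm_nonneg _)).trans h1
  have h4 : (4 / Real.log q) ^ M * ((1 + (d : ℝ)) / 4 * Real.log q) ^ M = (1 + (d : ℝ)) ^ M := by
    rw [← mul_pow]
    congr 1
    field_simp
  rw [← mul_div_assoc, le_div_iff₀ (by positivity), ← h4]
  calc ‖fourierCoeff q g n f‖ * ((4 / Real.log q) ^ M * ((1 + (d : ℝ)) / 4 * Real.log q) ^ M)
      = (4 / Real.log q) ^ M * (((1 + (d : ℝ)) / 4 * Real.log q) ^ M * ‖fourierCoeff q g n f‖) := by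
        ring
    _ ≤ (4 / Real.log q) ^ M * (C * B) := by gcongr
    _ = _ := by ring

lemma continuousOn_fourier_integrand (n : ℤ) {f g : ℝ → ℂ}
    (hf : ContinuousOn f (Set.Icc 0 (tau q))) (hg : Continuous g) :
    ContinuousOn (fun s : ℝ => Complex.exp (Complex.I * ((n * Real.log q) * s : ℝ)) * (f s * g s))
      (Set.Icc 0 (tau q)) := by
  refine ContinuousOn.mul ?_ (hf.mul hg.continuousOn)
  exact Continuous.continuousOn (by fun_prop)

lemma exists_fourierCoeff_sub_le (hq : 2 ≤ q) {g : ℝ → ℂ} (hg : Continuous g) :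
    ∃ C : ℝ, 0 ≤ C ∧ ∀ (f f' : ℝ → ℂ) (R : ℝ) (n : ℤ), ContinuousOn f (Set.Icc 0 (tau q)) →
      ContinuousOn f' (Set.Icc 0 (tau q)) → (∀ s ∈ Set.Icc 0 (tau q), ‖f s - f' s‖ ≤ R) →
      ‖fourierCoeff q g n f - fourierCoeff q g n f'‖ ≤ C * R := by
  have hT := tau_pos hq
  obtain ⟨D, hD⟩ := isCompact_Icc.exists_bound_of_continuousOn
    (s := Set.Icc 0 (tau q)) hg.continuousOn
  have hD0 : 0 ≤ D := (norm_nonneg _).trans (hD 0 ⟨le_rfl, hT.le⟩)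
  refine ⟨D * tau q, by positivity, fun f f' R n hf hf' hR => ?_⟩
  rw [fourierCoeff, fourierCoeff, ← intervalIntegral.integral_sub]
  · refine (intervalIntegral.norm_integral_le_of_norm_le_const (C := R * D) fun s hs => ?_).trans
      (le_of_eq ?_)
    · rw [Set.uIoc_of_le hT.le] at hs
      have hs' : s ∈ Set.Icc 0 (tau q) := ⟨hs.1.le, hs.2⟩
      rw [← mul_sub, ← sub_mul, norm_mul, Complex.norm_exp_I_mul_ofReal, one_mul, norm_mul]
      have := hR s hs'
      exact mul_le_mul this (hD s hs') (norm_nonneg _) ((norm_nonneg _).trans this)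
    · rw [sub_zero, abs_of_pos hT]; ring
  · refine ContinuousOn.intervalIntegrable ?_
    rw [Set.uIcc_of_le hT.le]
    exact continuousOn_fourier_integrand n hf hg
  · refine ContinuousOn.intervalIntegrable ?_
    rw [Set.uIcc_of_le hT.le]
    exact continuousOn_fourier_integrand n hf' hg

/-- Multiplication by `q^{2is}` raises the index by 2. This difference form produces the telescoping
in `integral_middle`. -/
lemma fourierCoeff_plancherel (hq : 2 ≤ q) (n : ℤ) {f : ℝ → ℂ}
    (hf : ContinuousOn f (Set.Icc 0 (tau q))) :
    fourierCoeff q (fun s => (plancherelDensity q s : ℂ)) n f =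
      fourierCoeff q (plancherelFactor q) (n + 2) f - fourierCoeff q (plancherelFactor q) n f := by
  have hT := tau_pos hq
  have hg := (contDiff_plancherelFactor hq).continuous
  have hi : ∀ n : ℤ, IntervalIntegrable (fun s : ℝ => Complex.exp
      (Complex.I * ((n * Real.log q) * s : ℝ)) * (f s * plancherelFactor q s)) volume 0 (tau q) := by
    intro n
    refine ContinuousOn.intervalIntegrable ?_
    rw [Set.uIcc_of_le hT.le]
    exact continuousOn_fourier_integrand n hf hg
  rw [fourierCoeff, fourierCoeff, fourierCoeff, ← intervalIntegral.integral_sub (hi _) (hi _)]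
  congr 1
  ext s
  have h : Complex.exp (Complex.I * ((((n + 2 : ℤ) : ℝ) * Real.log q) * s : ℝ)) =
      Complex.exp (Complex.I * ((n * Real.log q) * s : ℝ)) *
        Complex.exp (Complex.I * (2 * Real.log q * s : ℝ)) := by
    rw [← Complex.exp_add, ← mul_add, ← Complex.ofReal_add]
    congr 3
    push_cast
    ring
  rw [plancherelDensity_eq_factor hq, h]
  ring

variable {V : Type*} {G : SimpleGraph V} {o : V}

lemma continuous_fourierCoeff (hG : IsHomogeneousTree G q) {b : Boundary G o → ℝ → ℂ}
    (hb : ContinuousOn (fun p : Boundary G o × ℝ => b p.1 p.2) (Set.univ ×ˢ Set.Icc 0 (tau q)))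
    {g : ℝ → ℂ} (hg : Continuous g) (n : ℤ) :
    Continuous fun ω => fourierCoeff q g n (b ω) := by
  have hT := tau_pos hG.two_le
  have := secondCountable_boundary (o := o) hG
  -- Composing with the projection onto `[0, τ]` gives a function continuous in all real `s` without
  -- changing the integral.
  let p : ℝ → ℝ := fun s => Set.projIcc 0 (tau q) hT.le s
  have hp : Continuous p := continuous_subtype_val.comp continuous_projIcc
  have hc : Continuous fun z : Boundary G o × ℝ => b z.1 (p z.2) :=
    hb.comp_continuous (f := fun z : Boundary G o × ℝ => (z.1, p z.2))
      (continuous_fst.prodMk (hp.comp continuous_snd))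
      fun z => ⟨Set.mem_univ _, (Set.projIcc 0 (tau q) hT.le z.2).2⟩
  have heq : (fun ω => fourierCoeff q g n (b ω)) = fun ω => ∫ s in (0 : ℝ)..tau q,
      Complex.exp (Complex.I * ((n * Real.log q) * s : ℝ)) * (b ω (p s) * g s) := by
    ext ω
    refine intervalIntegral.integral_congr fun s hs => ?_
    rw [Set.uIcc_of_le hT.le] at hs
    simp only [p, Set.projIcc_of_mem hT.le hs]
  rw [heq]
  refine intervalIntegral.continuous_parametric_intervalIntegral_of_continuous' ?_ _ _
  refine Continuous.mul (by fun_prop) (hc.mul (hg.comp continuous_snd))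

lemma eq_sum_indicator_height (hG : IsHomogeneousTree G q) {E : Type*} [AddCommMonoid E] (x y : V)
    (F : ℤ → Boundary G o → E) (ω : Boundary G o) :
    F (height G ω y - height G ω x) ω = ∑ j ∈ Finset.range (G.dist x y + 1),
      Set.indicator {ω : Boundary G o | height G ω y - height G ω x = 2 * (j : ℤ) - G.dist x y}
        (F (2 * (j : ℤ) - G.dist x y)) ω := by
  obtain ⟨j, hj, hH⟩ := exists_height_sub hG.isTree ω x y
  rw [Finset.sum_eq_single j, Set.indicator_of_mem (by exact hH), hH]
  · intro i _ hij
    refine Set.indicator_of_notMem (fun h' => hij ?_) _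
    have h' : height G ω y - height G ω x = 2 * (i : ℤ) - G.dist x y := h'
    omega
  · intro h'
    exact absurd (Finset.mem_range.2 (by omega)) h'

variable [hG : IsHomogeneousTree G q]

/-- Integration of functions of the difference of heights. -/
lemma integral_comp_height {E : Type*} [NormedAddCommGroup E] [NormedSpace ℝ E] [CompleteSpace E]
    (x y : V) (F : ℤ → E) :
    Integrable (fun ω : Boundary G o => F (height G ω y - height G ω x)) (boundaryMeasure G q o x) ∧
    ∫ ω, F (height G ω y - height G ω x) ∂(boundaryMeasure G q o x) =
      ∑ j ∈ Finset.range (G.dist x y + 1), (boundaryMeasure G q o x).real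
        {ω | height G ω y - height G ω x = 2 * (j : ℤ) - G.dist x y} •
          F (2 * (j : ℤ) - G.dist x y) := by
  have h : (fun ω : Boundary G o => F (height G ω y - height G ω x)) = fun ω =>
      ∑ j ∈ Finset.range (G.dist x y + 1),
        ({ω | height G ω y - height G ω x = 2 * (j : ℤ) - G.dist x y} : Set (Boundary G o)).indicator
          (fun _ => F (2 * (j : ℤ) - G.dist x y)) ω := by
    exact funext fun ω => eq_sum_indicator_height hG x y (fun n _ => F n) ω
  have hint : ∀ j ∈ Finset.range (G.dist x y + 1), Integrable
      (({ω | height G ω y - height G ω x = 2 * (j : ℤ) - G.dist x y} :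
        Set (Boundary G o)).indicator (fun _ => F (2 * (j : ℤ) - G.dist x y)))
        (boundaryMeasure G q o x) := fun j _ =>
    (integrable_const _).indicator (measurableSet_level hG x y _)
  rw [h]
  refine ⟨integrable_finsetSum _ hint, ?_⟩
  rw [integral_finsetSum _ hint]
  exact Finset.sum_congr rfl fun j _ => integral_indicator_const _ (measurableSet_level hG x y _)

/-- The weight `q^{(2j-d)/2}` grows exactly as fast as the mass `q^{-j}` shrinks, so all levels
count equally. -/
lemma rpow_mul_level_le (o x y : V) {j : ℕ} (hj : j ≤ G.dist x y) :
    (boundaryMeasure G q o x).real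
      {ω : Boundary G o | height G ω y - height G ω x = 2 * (j : ℤ) - G.dist x y} *
        (q : ℝ) ^ (((2 * (j : ℤ) - G.dist x y : ℤ) : ℝ) / 2) ≤
      (q : ℝ) ^ (-(G.dist x y : ℝ) / 2) := by
  have hq : (0 : ℝ) < q := by linarith [two_le_real hG]
  refine (mul_le_mul_of_nonneg_right (measureReal_level_le (o := o) x y hj) (by positivity)).trans
    (le_of_eq ?_)
  rw [← Real.rpow_natCast, ← Real.rpow_neg hq.le, ← Real.rpow_add hq]
  congr 1
  push_cast
  ring

/-- The factor `1 + d(x, y)` is the number of levels. -/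
lemma norm_integral_le_of_height (x y : V) {Φ : Boundary G o → ℂ} {δ : ℝ} (hδ : 0 ≤ δ)
    (h : ∀ ω, ‖Φ ω‖ ≤ (q : ℝ) ^ (((height G ω y - height G ω x : ℤ) : ℝ) / 2) * δ) :
    ‖∫ ω, Φ ω ∂(boundaryMeasure G q o x)‖ ≤
      (q : ℝ) ^ (-(G.dist x y : ℝ) / 2) * (1 + (G.dist x y : ℝ)) * δ := by
  obtain ⟨h1, h2⟩ := integral_comp_height (G := G) (q := q) (o := o) x y
    fun n : ℤ => (q : ℝ) ^ ((n : ℝ) / 2) * δ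
  refine (norm_integral_le_of_norm_le h1 (ae_of_all _ h)).trans ?_
  rw [h2]
  refine (Finset.sum_le_card_nsmul _ _ ((q : ℝ) ^ (-(G.dist x y : ℝ) / 2) * δ) ?_).trans
    (le_of_eq ?_)
  · intro j hj
    rw [smul_eq_mul, ← mul_assoc]
    exact mul_le_mul_of_nonneg_right
      (rpow_mul_level_le o x y (Nat.lt_succ_iff.1 (Finset.mem_range.1 hj))) hδ
  · rw [Finset.card_range, nsmul_eq_mul]
    push_cast
    ring

variable (G) in
/-- The kernel attached to a symbol `b` which does not depend on a vertex. -/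
noncomputable def boundaryKernel (q : ℕ) [IsHomogeneousTree G q] (x y : V)
    (b : Boundary G o → ℝ → ℂ) : ℂ :=
  ∫ ω, (((q : ℝ) ^ (((height G ω y - height G ω x : ℤ) : ℝ) / 2) : ℝ) : ℂ) *
    fourierCoeff q (fun s => (plancherelDensity q s : ℂ)) (height G ω y - height G ω x) (b ω)
      ∂(boundaryMeasure G q o x)

lemma inner_integral_eq (hq : 2 ≤ q) (H : ℤ) (f : ℝ → ℂ) :
    (∫ s in (0 : ℝ)..tau q, (q : ℂ) ^ ((1 / 2 + Complex.I * (s : ℂ)) * ((H : ℤ) : ℂ)) * f s *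
      (plancherelDensity q s : ℂ)) =
    (((q : ℝ) ^ ((H : ℝ) / 2) : ℝ) : ℂ) *
      fourierCoeff q (fun s => (plancherelDensity q s : ℂ)) H f := by
  have hq0 : (0 : ℝ) < q := by exact_mod_cast (by omega : 0 < q)
  rw [fourierCoeff, ← intervalIntegral.integral_const_mul]
  congr 1
  ext s
  rw [natCast_cpow hq, Real.rpow_def_of_pos hq0, Complex.ofReal_exp, mul_assoc (Complex.exp _),
    ← mul_assoc (Complex.exp _) (Complex.exp _), ← Complex.exp_add]
  congr 2
  rw [Complex.ofReal_mul, Complex.ofReal_mul, Complex.ofReal_mul]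
  simp only [Complex.ofReal_div, Complex.ofReal_intCast, Complex.ofReal_ofNat]
  ring

lemma kernel_eq_boundaryKernel (a : V → Boundary G o → ℝ → ℂ) (x y : V) :
    kernel G q a x y = boundaryKernel G q x y (a x) := by
  rw [kernel, boundaryKernel]
  congr 1
  ext ω
  exact inner_integral_eq hG.two_le _ _

lemma integrable_boundaryKernel (x y : V) {b : Boundary G o → ℝ → ℂ}
    (hb : ContinuousOn (fun p : Boundary G o × ℝ => b p.1 p.2)
      (Set.univ ×ˢ Set.Icc 0 (tau q))) :
    Integrable (fun ω => (((q : ℝ) ^ (((height G ω y - height G ω x : ℤ) : ℝ) / 2) : ℝ) : ℂ) *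
      fourierCoeff q (fun s => (plancherelDensity q s : ℂ)) (height G ω y - height G ω x) (b ω))
      (boundaryMeasure G q o x) := by
  have := secondCountable_boundary (o := o) hG
  have := compactSpace_boundary G q o
  have hg := (contDiff_plancherelDensity hG.two_le).continuous
  have h : (fun ω : Boundary G o =>
      (((q : ℝ) ^ (((height G ω y - height G ω x : ℤ) : ℝ) / 2) : ℝ) : ℂ) *
      fourierCoeff q (fun s => (plancherelDensity q s : ℂ)) (height G ω y - height G ω x) (b ω)) =
      fun ω => ∑ j ∈ Finset.range (G.dist x y + 1),
        ({ω | height G ω y - height G ω x = 2 * (j : ℤ) - G.dist x y} :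
          Set (Boundary G o)).indicator (fun ω =>
            (((q : ℝ) ^ (((2 * (j : ℤ) - G.dist x y : ℤ) : ℝ) / 2) : ℝ) : ℂ) *
      fourierCoeff q (fun s => (plancherelDensity q s : ℂ)) (2 * (j : ℤ) - G.dist x y) (b ω)) ω := by
    exact funext fun ω => eq_sum_indicator_height hG x y (fun n ω =>
      (((q : ℝ) ^ ((n : ℝ) / 2) : ℝ) : ℂ) *
        fourierCoeff q (fun s => (plancherelDensity q s : ℂ)) n (b ω)) ω
  rw [h]
  refine integrable_finsetSum _ fun j _ => Integrable.indicator ?_ (measurableSet_level hG x y _)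
  refine Integrable.const_mul ?_ _
  exact (continuous_fourierCoeff hG hb hg _).integrable_of_hasCompactSupport
    (HasCompactSupport.of_compactSpace _)

/-- The sum of the Fourier coefficients over the middle part of a geodesic telescopes. -/
lemma integral_middle (x y : V) {m : ℕ} (hm : 1 ≤ m) (hmd : 2 * m ≤ G.dist x y) {f : ℝ → ℂ}
    (hf : ContinuousOn f (Set.Icc 0 (tau q))) :
    ∫ ω : Boundary G o, (fun n : ℤ => if |n| ≤ (G.dist x y : ℤ) - 2 * m then
      (((q : ℝ) ^ ((n : ℝ) / 2) : ℝ) : ℂ) *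
        fourierCoeff q (fun s => (plancherelDensity q s : ℂ)) n f else 0)
          (height G ω y - height G ω x) ∂(boundaryMeasure G q o x) =
      ((((q : ℝ) - 1) / (q + 1) * (q : ℝ) ^ (-(G.dist x y : ℝ) / 2) : ℝ) : ℂ) *
        (fourierCoeff q (plancherelFactor q) ((G.dist x y : ℤ) - 2 * m + 2) f -
          fourierCoeff q (plancherelFactor q) (2 * m - (G.dist x y : ℤ)) f) := by
  have hq : (0 : ℝ) < q := by linarith [two_le_real hG]
  rw [(integral_comp_height x y (fun n : ℤ => if |n| ≤ (G.dist x y : ℤ) - 2 * m then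
      (((q : ℝ) ^ ((n : ℝ) / 2) : ℝ) : ℂ) *
        fourierCoeff q (fun s => (plancherelDensity q s : ℂ)) n f else 0)).2]
  -- The condition `|2j - d| ≤ d - 2m` means `m ≤ j ≤ d - m`; as `m ≥ 1`, the exceptional end levels
  -- are left out.
  have hsub : Finset.Ico m (G.dist x y - m + 1) ⊆ Finset.range (G.dist x y + 1) := by
    intro j hj
    rw [Finset.mem_Ico] at hj
    rw [Finset.mem_range]
    omega
  rw [← Finset.sum_subset hsub]
  · have key : ∀ j ∈ Finset.Ico m (G.dist x y - m + 1), (boundaryMeasure G q o x).real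
        {ω | height G ω y - height G ω x = 2 * (j : ℤ) - G.dist x y} •
          (if |2 * (j : ℤ) - G.dist x y| ≤ (G.dist x y : ℤ) - 2 * m then
            (((q : ℝ) ^ (((2 * (j : ℤ) - G.dist x y : ℤ) : ℝ) / 2) : ℝ) : ℂ) *
            fourierCoeff q (fun s => (plancherelDensity q s : ℂ)) (2 * (j : ℤ) - G.dist x y) f
            else 0) =
        ((((q : ℝ) - 1) / (q + 1) * (q : ℝ) ^ (-(G.dist x y : ℝ) / 2) : ℝ) : ℂ) *
          (fourierCoeff q (plancherelFactor q) (2 * ((j + 1 : ℕ) : ℤ) - G.dist x y) f -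
            fourierCoeff q (plancherelFactor q) (2 * (j : ℤ) - G.dist x y) f) := by
      intro j hj
      rw [Finset.mem_Ico] at hj
      rw [if_pos (abs_le.2 (by omega)), measureReal_level x y (by omega) (by omega),
        fourierCoeff_plancherel hG.two_le _ hf, Complex.real_smul, ← mul_assoc,
        ← Complex.ofReal_mul]
      congr 2
      · rw [mul_assoc]
        congr 1
        rw [← Real.rpow_natCast, ← Real.rpow_neg hq.le, ← Real.rpow_add hq]
        congr 1
        push_cast
        ring
      · rw [show 2 * ((j + 1 : ℕ) : ℤ) - G.dist x y = 2 * (j : ℤ) - G.dist x y + 2 by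
          push_cast; ring]
    rw [Finset.sum_congr rfl key, ← Finset.mul_sum,
      Finset.sum_Ico_sub (fun j : ℕ => fourierCoeff q (plancherelFactor q)
        (2 * (j : ℤ) - G.dist x y) f) (by omega)]
    congr 3
    push_cast [Nat.cast_sub (show m ≤ G.dist x y by omega)]
    ring
  · intro j hj hj'
    rw [Finset.mem_Ico] at hj'
    rw [Finset.mem_range] at hj
    rw [if_neg, smul_zero]
    rw [abs_le]
    omega

/-- The main estimate: the kernel is controlled by the derivatives of the symbol in `s`, and by its
variation in `ω` on the set of boundary points seen from the middle part of `[x, y]`. -/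
theorem exists_boundaryKernel_bound (G : SimpleGraph V) (q : ℕ) [hG : IsHomogeneousTree G q]
    (o : V) (M : ℕ) :
    ∃ C : ℝ, 0 ≤ C ∧ ∀ (x y : V) (b : Boundary G o → ℝ → ℂ) (B R : ℝ), 0 ≤ R →
      (∀ ω, IsFlat (tau q) (b ω)) →
      ContinuousOn (fun p : Boundary G o × ℝ => b p.1 p.2) (Set.univ ×ˢ Set.Icc 0 (tau q)) →
      (∀ k ≤ M, ∀ ω, ∀ s ∈ Set.Icc 0 (tau q), ‖derivS q k (b ω) s‖ ≤ B) →
      (∀ ω ω', |height G ω y - height G ω x| ≤ (G.dist x y : ℤ) - 2 * (G.dist x y / 4 : ℕ) →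
        |height G ω' y - height G ω' x| ≤ (G.dist x y : ℤ) - 2 * (G.dist x y / 4 : ℕ) →
        ∀ s ∈ Set.Icc 0 (tau q), ‖b ω s - b ω' s‖ ≤ R) →
      ‖boundaryKernel G q x y b‖ ≤ C * ((q : ℝ) ^ (-(G.dist x y : ℝ) / 2) *
        (1 + (G.dist x y : ℝ)) * (B / (1 + (G.dist x y : ℝ)) ^ M + R)) := by
  have hq := two_le_real hG
  have hτ := tau_pos hG.two_le
  have hgc := contDiff_plancherelDensity hG.two_le
  obtain ⟨C₀, hC₀, h₀⟩ := exists_oscillatory_bound hτ 0 _ hgc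
  obtain ⟨C₁, hC₁, h₁⟩ := exists_fourierCoeff_bound hG.two_le M hgc
  obtain ⟨C₂, hC₂, h₂⟩ := exists_fourierCoeff_sub_le hG.two_le hgc.continuous
  obtain ⟨C₃, hC₃, h₃⟩ := exists_fourierCoeff_bound hG.two_le M
    (contDiff_plancherelFactor hG.two_le)
  obtain ⟨ω₁⟩ := nonempty_boundary G q o
  refine ⟨C₀ * 4 ^ M + C₁ + C₂ + 2 * C₃, by positivity,
    fun x y b B R hR hflat hcont hB hmid => ?_⟩
  have hB0 : 0 ≤ B := (norm_nonneg _).trans (hB 0 (by omega) ω₁ 0 ⟨le_rfl, hτ.le⟩)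
  set d := G.dist x y with hd
  set w : ℝ := (q : ℝ) ^ (-(d : ℝ) / 2) with hw
  have hw0 : 0 ≤ w := by positivity
  -- For `d < 4` the cut `d / 4` is 0 and the middle would contain the end levels. No decay is
  -- needed then, since `1 + d ≤ 4`; this accounts for the constant `C₀ * 4 ^ M`.
  rcases lt_or_ge d 4 with h4 | h4
  · have hδ : ∀ ω : Boundary G o, ‖(((q : ℝ) ^ (((height G ω y - height G ω x : ℤ) : ℝ) / 2) : ℝ) : ℂ)
        * fourierCoeff q (fun s => (plancherelDensity q s : ℂ)) (height G ω y - height G ω x) (b ω)‖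
        ≤ (q : ℝ) ^ (((height G ω y - height G ω x : ℤ) : ℝ) / 2) * (C₀ * B) := by
      intro ω
      rw [norm_mul, Complex.norm_real, Real.norm_of_nonneg (by positivity)]
      have := h₀ (b ω) B ((height G ω y - height G ω x : ℤ) * Real.log q) (hflat ω)
        fun k hk s hs => hB k (by omega) ω s hs
      rw [pow_zero, one_mul] at this
      exact mul_le_mul_of_nonneg_left this (by positivity)
    refine (norm_integral_le_of_height x y (by positivity) hδ).trans ?_
    rw [← hd, ← hw]
    have h5 : B ≤ 4 ^ M * (B / (1 + (d : ℝ)) ^ M) := by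
      rw [← mul_div_assoc, le_div_iff₀ (by positivity), mul_comm]
      have : 1 + (d : ℝ) ≤ 4 := by
        have : (d : ℝ) ≤ 3 := by exact_mod_cast Nat.lt_succ_iff.1 h4
        linarith
      gcongr
    have h6 : 0 ≤ B / (1 + (d : ℝ)) ^ M := by positivity
    have h7 : C₀ * B ≤ (C₀ * 4 ^ M + C₁ + C₂ + 2 * C₃) * (B / (1 + (d : ℝ)) ^ M + R) := by
      have : C₀ * B ≤ C₀ * (4 ^ M * (B / (1 + (d : ℝ)) ^ M)) := by gcongr
      have h8 : 0 ≤ C₀ * 4 ^ M * R := by positivity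
      have h9 : 0 ≤ (C₁ + C₂ + 2 * C₃) * (B / (1 + (d : ℝ)) ^ M + R) := by positivity
      linarith
    calc w * (1 + (d : ℝ)) * (C₀ * B)
        ≤ w * (1 + (d : ℝ)) * ((C₀ * 4 ^ M + C₁ + C₂ + 2 * C₃) * (B / (1 + (d : ℝ)) ^ M + R)) := by
          gcongr
      _ = _ := by ring
  · set m := d / 4 with hm
    -- The level of the cut has positive mass, which provides a boundary point `ω₀` at which the
    -- symbol is frozen.
    have hne : {ω : Boundary G o | height G ω y - height G ω x = 2 * (m : ℤ) - d}.Nonempty := by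
      have h5 := measureReal_level (G := G) (q := q) (o := o) x y (j := m) (by omega) (by omega)
      by_contra h6
      rw [Set.not_nonempty_iff_eq_empty] at h6
      rw [← hd, h6, measureReal_empty] at h5
      have : 0 < ((q : ℝ) - 1) / (q + 1) * ((q : ℝ) ^ m)⁻¹ := by
        have : (0 : ℝ) < q - 1 := by linarith
        positivity
      linarith
    obtain ⟨ω₀, hω₀⟩ := hne
    have hω₀' : |height G ω₀ y - height G ω₀ x| ≤ (d : ℤ) - 2 * m := by
      have : height G ω₀ y - height G ω₀ x = 2 * (m : ℤ) - d := hω₀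
      rw [this, abs_le]
      omega
    set Φ₀ : ℤ → ℂ := fun n : ℤ => if |n| ≤ (d : ℤ) - 2 * m then
      (((q : ℝ) ^ ((n : ℝ) / 2) : ℝ) : ℂ) *
        fourierCoeff q (fun s => (plancherelDensity q s : ℂ)) n (b ω₀) else 0 with hΦ₀
    have hint := integrable_boundaryKernel x y hcont
    have hint₀ := (integral_comp_height (G := G) (q := q) (o := o) x y Φ₀).1
    set X := B / (1 + (d : ℝ)) ^ M with hX
    have hX0 : 0 ≤ X := by positivity
    -- Replacing `b ω` by `b ω₀` costs `R` in the middle; outside, where `Φ₀` is 0, the coefficient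
    -- itself is small.
    have e1 : ‖∫ ω : Boundary G o, ((((q : ℝ) ^ (((height G ω y - height G ω x : ℤ) : ℝ) / 2) : ℝ) : ℂ)
        * fourierCoeff q (fun s => (plancherelDensity q s : ℂ)) (height G ω y - height G ω x) (b ω)
        - Φ₀ (height G ω y - height G ω x)) ∂(boundaryMeasure G q o x)‖ ≤
        w * (1 + (d : ℝ)) * (C₁ * X + C₂ * R) := by
      refine norm_integral_le_of_height x y (by positivity) fun ω => ?_
      by_cases hω : |height G ω y - height G ω x| ≤ (d : ℤ) - 2 * m
      · simp only [hΦ₀]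
        rw [if_pos hω, ← mul_sub, norm_mul, Complex.norm_real, Real.norm_of_nonneg (by positivity)]
        refine mul_le_mul_of_nonneg_left ((h₂ _ _ R _ (hflat ω).smooth.continuousOn
          (hflat ω₀).smooth.continuousOn (hmid ω ω₀ hω hω₀')).trans ?_) (by positivity)
        have : 0 ≤ C₁ * X := by positivity
        linarith
      · simp only [hΦ₀]
        rw [if_neg hω, sub_zero, norm_mul, Complex.norm_real, Real.norm_of_nonneg (by positivity)]
        refine mul_le_mul_of_nonneg_left ((h₁ _ B _ d (hflat ω) (fun k hk => hB k hk ω) ?_).trans ?_)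
          (by positivity)
        · have : (1 : ℤ) + d ≤ 4 * |height G ω y - height G ω x| := by omega
          exact_mod_cast this
        · have : 0 ≤ C₂ * R := by positivity
          linarith
    -- The frozen middle part telescopes to two coefficients, of indices `d - 2m + 2` and `2m - d`.
    have e2 : ‖∫ ω : Boundary G o, Φ₀ (height G ω y - height G ω x) ∂(boundaryMeasure G q o x)‖ ≤
        w * (2 * C₃ * X) := by
      rw [hΦ₀, integral_middle x y (by omega) (by omega) (hflat ω₀).smooth.continuousOn, norm_mul,
        Complex.norm_real, Real.norm_of_nonneg (mul_nonneg (div_nonneg (by linarith) (by positivity))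
        (by positivity)), ← hd, ← hw]
      have h5 : ((q : ℝ) - 1) / (q + 1) ≤ 1 := by
        rw [div_le_one (by positivity)]
        linarith
      have h6 : ((q : ℝ) - 1) / (q + 1) * w ≤ w := mul_le_of_le_one_left hw0 h5
      refine mul_le_mul h6 ((norm_sub_le _ _).trans ?_) (norm_nonneg _) hw0
      have h7 := h₃ _ B ((d : ℤ) - 2 * m + 2) d (hflat ω₀) (fun k hk => hB k hk ω₀) (by
        have := le_abs_self ((d : ℤ) - 2 * m + 2)
        have : (1 : ℤ) + d ≤ 4 * |(d : ℤ) - 2 * m + 2| := by omega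
        exact_mod_cast this)
      have h8 := h₃ _ B (2 * m - (d : ℤ)) d (hflat ω₀) (fun k hk => hB k hk ω₀) (by
        have := neg_le_abs (2 * m - (d : ℤ))
        have : (1 : ℤ) + d ≤ 4 * |2 * m - (d : ℤ)| := by omega
        exact_mod_cast this)
      linarith
    rw [boundaryKernel, ← sub_add_cancel (∫ ω : Boundary G o, _ ∂(boundaryMeasure G q o x))
      (∫ ω : Boundary G o, Φ₀ (height G ω y - height G ω x) ∂(boundaryMeasure G q o x)),
      ← integral_sub hint hint₀]
    refine (norm_add_le _ _).trans ((add_le_add e1 e2).trans ?_)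
    have h5 : w * (2 * C₃ * X) ≤ w * (1 + (d : ℝ)) * (2 * C₃ * X) := by
      have : w ≤ w * (1 + (d : ℝ)) := le_mul_of_one_le_right hw0 (by simp)
      gcongr
    have h6 : C₁ * X + C₂ * R + 2 * C₃ * X ≤ (C₀ * 4 ^ M + C₁ + C₂ + 2 * C₃) * (X + R) := by
      have : 0 ≤ C₀ * 4 ^ M * (X + R) + C₁ * R + C₂ * X + 2 * C₃ * R := by positivity
      linarith
    have h7 : w * (1 + (d : ℝ)) * (C₁ * X + C₂ * R + 2 * C₃ * X) ≤
        w * (1 + (d : ℝ)) * ((C₀ * 4 ^ M + C₁ + C₂ + 2 * C₃) * (X + R)) := by gcongr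
    linarith

end KernelEstimate

/-! ### Kernels of symbols -/

section Conjugation

variable {q : ℕ}

lemma derivS_conj (hq : 2 ≤ q) (k : ℕ) (f : ℝ → ℂ) {s : ℝ} (hs : s ∈ Set.Icc 0 (tau q)) :
    derivS q k (fun s => conj (f s)) s = conj (derivS q k f s) := by
  have huniq := uniqueDiffOn_Icc (tau_pos hq)
  unfold derivS
  induction k generalizing s with
  | zero => simp
  | succ k ih =>
    rw [iteratedDerivWithin_succ, iteratedDerivWithin_succ,
      derivWithin_congr (fun t ht => ih ht) (ih hs)]
    exact derivWithin.star

/-- The density is real, so only the sign of the frequency changes. Exchanging `x` and `y` in the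
height difference restores it. -/
lemma conj_fourierCoeff (n : ℤ) (f : ℝ → ℂ) :
    conj (fourierCoeff q (fun s => (plancherelDensity q s : ℂ)) n f) =
      fourierCoeff q (fun s => (plancherelDensity q s : ℂ)) (-n) fun s => conj (f s) := by
  rw [fourierCoeff, fourierCoeff, intervalIntegral, map_sub, ← integral_conj, ← integral_conj]
  rw [← intervalIntegral]
  congr 1
  ext s
  rw [map_mul, map_mul, Complex.conj_ofReal, ← Complex.exp_conj, map_mul, Complex.conj_I,
    Complex.conj_ofReal]
  congr 2
  push_cast
  ring

variable {V : Type*} {G : SimpleGraph V} [hG : IsHomogeneousTree G q] {o : V}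

lemma avg_conj (x : V) (n : ℕ) (η : Boundary G o → ℂ) (ω : Boundary G o) :
    avg G q x n (fun ω' => conj (η ω')) ω = conj (avg G q x n η ω) := by
  rw [avg, avg, average, average, integral_conj]

lemma IsSemiclassicalSymbol.conj {ε₀ : ℝ} {a : ℝ → V → Boundary G o → ℝ → ℂ}
    (ha : IsSemiclassicalSymbol G q ε₀ a) :
    IsSemiclassicalSymbol G q ε₀ fun ε => conjSymbol (a ε) where
  smooth ε hε x ω := Complex.conjCLE.contDiff.comp_contDiffOn (ha.smooth ε hε x ω)
  continuous_deriv ε hε x k := by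
    refine (Complex.continuous_conj.comp_continuousOn (ha.continuous_deriv ε hε x k)).congr ?_
    intro p hp
    exact derivS_conj hG.two_le k _ hp.2
  regular l := by
    obtain ⟨C, hC⟩ := ha.regular l
    refine ⟨C, fun ε hε n x ω s hs => ?_⟩
    simp only [conjSymbol, avg_conj, ← map_sub, RCLike.norm_conj]
    exact hC ε hε n x ω s hs
  boundary ε hε k x ω := by
    have hτ := tau_pos hG.two_le
    obtain ⟨h1, h2⟩ := ha.boundary ε hε k x ω
    constructor
    · have := derivS_conj hG.two_le k (a ε x ω) (s := 0) ⟨le_rfl, hτ.le⟩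
      rw [h1, map_zero] at this
      exact this
    · have := derivS_conj hG.two_le k (a ε x ω) (s := tau q) ⟨hτ.le, le_rfl⟩
      rw [h2, map_zero] at this
      exact this
  lipschitz k := by
    obtain ⟨C, hC⟩ := ha.lipschitz k
    refine ⟨C, fun ε hε x y ω s hs => ?_⟩
    have h := hC ε hε x y ω s hs
    rw [← RCLike.norm_conj, map_sub, ← derivS_conj hG.two_le k _ hs,
      ← derivS_conj hG.two_le k _ hs] at h
    exact h
  cross l := by
    obtain ⟨C, hC⟩ := ha.cross l
    refine ⟨C, fun ε hε x y n ω s hs => ?_⟩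
    simp only [conjSymbol, avg_conj, ← map_sub, RCLike.norm_conj]
    exact hC ε hε x y n ω s hs

/-- The adjoint of a kernel, by the change of base point in the boundary measures. -/
lemma conj_boundaryKernel (x y : V) (b : Boundary G o → ℝ → ℂ) :
    conj (boundaryKernel G q y x b) = boundaryKernel G q x y fun ω s => conj (b ω s) := by
  have hq : (0 : ℝ) < q := by linarith [two_le_real hG]
  have hmeas : Measurable fun ω : Boundary G o =>
      ENNReal.ofReal ((q : ℝ) ^ (height G ω y - height G ω x)) :=
    (measurable_of_countable fun n : ℤ => ENNReal.ofReal ((q : ℝ) ^ n)).comp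
      (measurable_height_sub hG x y)
  rw [boundaryKernel, boundaryKernel, ← integral_conj, boundaryMeasure_eq_withDensity q x y,
    integral_withDensity_eq_integral_toReal_smul hmeas (ae_of_all _ fun _ => ENNReal.ofReal_lt_top)]
  congr 1
  ext ω
  rw [map_mul, conj_fourierCoeff, Complex.conj_ofReal, ENNReal.toReal_ofReal (by positivity),
    Complex.real_smul, ← mul_assoc, ← Complex.ofReal_mul, neg_sub]
  -- With `H = h_ω(y) - h_ω(x)`, the density `q^H` turns the weight `q^{-H/2}` of the kernel at `(y,
  -- x)` into `q^{H/2}`.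
  congr 2
  rw [← Real.rpow_intCast, ← Real.rpow_add hq]
  congr 1
  push_cast
  ring

lemma boundaryKernel_sub (x y : V) {b b' : Boundary G o → ℝ → ℂ}
    (hb : ContinuousOn (fun p : Boundary G o × ℝ => b p.1 p.2) (Set.univ ×ˢ Set.Icc 0 (tau q)))
    (hb' : ContinuousOn (fun p : Boundary G o × ℝ => b' p.1 p.2)
      (Set.univ ×ˢ Set.Icc 0 (tau q))) :
    boundaryKernel G q x y b - boundaryKernel G q x y b' =
      boundaryKernel G q x y fun ω s => b ω s - b' ω s := by
  have hτ := tau_pos hG.two_le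
  have hg := (contDiff_plancherelDensity hG.two_le).continuous
  rw [boundaryKernel, boundaryKernel, ← integral_sub (integrable_boundaryKernel x y hb)
    (integrable_boundaryKernel x y hb'), boundaryKernel]
  congr 1
  ext ω
  have hc : ∀ {b : Boundary G o → ℝ → ℂ},
      ContinuousOn (fun p : Boundary G o × ℝ => b p.1 p.2) (Set.univ ×ˢ Set.Icc 0 (tau q)) →
      ∀ n : ℤ, IntervalIntegrable (fun s : ℝ => Complex.exp
        (Complex.I * ((n * Real.log q) * s : ℝ)) * (b ω s * (plancherelDensity q s : ℂ)))
          volume 0 (tau q) := by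
    intro b hb n
    refine ContinuousOn.intervalIntegrable ?_
    rw [Set.uIcc_of_le hτ.le]
    refine continuousOn_fourier_integrand n ?_ hg
    exact hb.comp (f := fun s : ℝ => (ω, s)) (by fun_prop) fun s hs => ⟨Set.mem_univ _, hs⟩
  rw [← mul_sub, fourierCoeff, fourierCoeff, fourierCoeff,
    ← intervalIntegral.integral_sub (hc hb _) (hc hb' _)]
  congr 2
  ext s
  ring

end Conjugation

/-! ### Kernel bounds for semi-classical symbols and for the remainder -/

section SymbolEstimates

variable {q : ℕ} {V : Type*} {G : SimpleGraph V} [hG : IsHomogeneousTree G q] {o : V}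
  {ε₀ : ℝ} {a : ℝ → V → Boundary G o → ℝ → ℂ}

lemma IsSemiclassicalSymbol.isFlat (ha : IsSemiclassicalSymbol G q ε₀ a) {ε : ℝ}
    (hε : ε ∈ Set.Ioo 0 ε₀) (x : V) (ω : Boundary G o) : IsFlat (tau q) (a ε x ω) :=
  ⟨ha.smooth ε hε x ω, fun k => (ha.boundary ε hε k x ω).1, fun k => (ha.boundary ε hε k x ω).2⟩

lemma IsSemiclassicalSymbol.continuousOn (ha : IsSemiclassicalSymbol G q ε₀ a) {ε : ℝ}
    (hε : ε ∈ Set.Ioo 0 ε₀) (x : V) :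
    ContinuousOn (fun p : Boundary G o × ℝ => a ε x p.1 p.2)
      (Set.univ ×ˢ Set.Icc 0 (tau q)) := by
  simpa [derivS] using ha.continuous_deriv ε hε x 0

lemma IsFlat.sub (hq : 2 ≤ q) {f g : ℝ → ℂ} (hf : IsFlat (tau q) f) (hg : IsFlat (tau q) g) :
    IsFlat (tau q) (fun s => f s - g s) ∧ ∀ k : ℕ, ∀ s ∈ Set.Icc 0 (tau q),
      derivS q k (fun s => f s - g s) s = derivS q k f s - derivS q k g s := by
  have hτ := tau_pos hq
  have h : ∀ k : ℕ, ∀ s ∈ Set.Icc 0 (tau q),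
      derivS q k (fun s => f s - g s) s = derivS q k f s - derivS q k g s := by
    intro k s hs
    exact iteratedDerivWithin_sub hs (uniqueDiffOn_Icc hτ)
      ((hf.smooth s hs).of_le (by exact_mod_cast le_top))
      ((hg.smooth s hs).of_le (by exact_mod_cast le_top))
  refine ⟨⟨hf.smooth.sub hg.smooth, fun k => ?_, fun k => ?_⟩, h⟩
  · have := h k 0 ⟨le_rfl, hτ.le⟩
    unfold derivS at this
    rw [this, hf.left, hg.left, sub_zero]
  · have := h k (tau q) ⟨hτ.le, le_rfl⟩
    unfold derivS at this
    rw [this, hf.right, hg.right, sub_zero]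

/-- The derivatives of a symbol at a given vertex are bounded. -/
lemma IsSemiclassicalSymbol.exists_deriv_bound (ha : IsSemiclassicalSymbol G q ε₀ a) {ε : ℝ}
    (hε : ε ∈ Set.Ioo 0 ε₀) (x : V) (M : ℕ) : ∃ B : ℝ, 0 ≤ B ∧ ∀ k ≤ M, ∀ ω : Boundary G o,
      ∀ s ∈ Set.Icc 0 (tau q), ‖derivS q k (a ε x ω) s‖ ≤ B := by
  have := compactSpace_boundary G q o
  have h : ∀ k : ℕ, ∃ B : ℝ, ∀ p ∈ (Set.univ : Set (Boundary G o)) ×ˢ Set.Icc 0 (tau q),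
      ‖derivS q k (a ε x p.1) p.2‖ ≤ B := fun k =>
    (isCompact_univ.prod isCompact_Icc).exists_bound_of_continuousOn (ha.continuous_deriv ε hε x k)
  choose B hB using h
  refine ⟨∑ k ∈ Finset.range (M + 1), |B k|, Finset.sum_nonneg fun _ _ => abs_nonneg _,
    fun k hk ω s hs => ?_⟩
  exact (hB k (ω, s) ⟨Set.mem_univ _, hs⟩).trans ((le_abs_self _).trans
    (Finset.single_le_sum (f := fun k => |B k|) (fun _ _ => abs_nonneg _)
      (Finset.mem_range.2 (by omega))))

lemma IsSemiclassicalSymbol.exists_lipschitz_bound (ha : IsSemiclassicalSymbol G q ε₀ a) (M : ℕ) :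
    ∃ C : ℝ, 0 ≤ C ∧ ∀ k ≤ M, ∀ ε ∈ Set.Ioo 0 ε₀, ∀ (x y : V) (ω : Boundary G o),
      ∀ s ∈ Set.Icc 0 (tau q),
        ‖derivS q k (a ε x ω) s - derivS q k (a ε y ω) s‖ ≤ C * ε * (G.dist x y : ℝ) := by
  choose C hC using ha.lipschitz
  refine ⟨∑ k ∈ Finset.range (M + 1), |C k|, Finset.sum_nonneg fun _ _ => abs_nonneg _,
    fun k hk ε hε x y ω s hs => (hC k ε hε x y ω s hs).trans ?_⟩
  have h1 : C k ≤ ∑ k ∈ Finset.range (M + 1), |C k| := (le_abs_self _).trans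
    (Finset.single_le_sum (f := fun k => |C k|) (fun _ _ => abs_nonneg _)
      (Finset.mem_range.2 (by omega)))
  have h2 := hε.1
  gcongr

/-- The symbol at either end point of `[x, y]` hardly varies over the boundary points seen from the
middle part of `[x, y]`. -/
lemma IsSemiclassicalSymbol.exists_variation_bound (ha : IsSemiclassicalSymbol G q ε₀ a) (l : ℕ) :
    ∃ D : ℝ, 0 ≤ D ∧ ∀ ε ∈ Set.Ioo 0 ε₀, ∀ (x y : V) (ω ω' : Boundary G o),
      |height G ω y - height G ω x| ≤ (G.dist x y : ℤ) - 2 * (G.dist x y / 4 : ℕ) →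
      |height G ω' y - height G ω' x| ≤ (G.dist x y : ℤ) - 2 * (G.dist x y / 4 : ℕ) →
      ∀ s ∈ Set.Icc 0 (tau q),
        ‖a ε x ω s - a ε x ω' s‖ ≤ D / (1 + (G.dist x y : ℝ)) ^ l := by
  obtain ⟨C, hC⟩ := ha.regular l
  refine ⟨2 * |C| * 4 ^ l, by positivity, fun ε hε x y ω ω' h h' s hs => ?_⟩
  set d := G.dist x y with hd
  -- Both rays follow `[x, y]` for `d / 4` steps, so the two averages of order `d / 4` are the same
  -- number and cancel in the difference.
  have htr := truncCylinder_eq_of_height hG.isTree (n := d / 4) (x := x) (y := y) (ω := ω)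
    (ω' := ω') (by omega) (by have := neg_le_of_abs_le h; omega)
    (by have := neg_le_of_abs_le h'; omega)
  have h1 := hC ε hε (d / 4) x ω s hs
  have h2 := hC ε hε (d / 4) x ω' s hs
  have h3 : avg G q x (d / 4) (fun ω' => a ε x ω' s) ω =
      avg G q x (d / 4) (fun ω' => a ε x ω' s) ω' := by rw [avg, avg, htr]
  rw [h3] at h1
  have h4 : C / (1 + ((d / 4 : ℕ) : ℝ)) ^ l ≤ |C| * 4 ^ l / (1 + (d : ℝ)) ^ l := by
    have h5 : (1 + (d : ℝ)) ≤ 4 * (1 + ((d / 4 : ℕ) : ℝ)) := by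
      have : 1 + d ≤ 4 * (1 + d / 4) := by omega
      exact_mod_cast this
    rw [div_le_div_iff₀ (by positivity) (by positivity)]
    calc C * (1 + (d : ℝ)) ^ l ≤ |C| * (4 * (1 + ((d / 4 : ℕ) : ℝ))) ^ l := by
          gcongr
          exact le_abs_self C
      _ = _ := by rw [mul_pow]; ring
  calc ‖a ε x ω s - a ε x ω' s‖
      = ‖(a ε x ω s - avg G q x (d / 4) (fun ω' => a ε x ω' s) ω') -
          (a ε x ω' s - avg G q x (d / 4) (fun ω' => a ε x ω' s) ω')‖ := by
        congr 1; ring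
    _ ≤ _ := (norm_sub_le _ _).trans (add_le_add (h1.trans h4) (h2.trans h4))
    _ = _ := by ring

/-- The decay of the kernel of `Op(a)`. -/
lemma IsSemiclassicalSymbol.exists_kernel_bound (ha : IsSemiclassicalSymbol G q ε₀ a) :
    ∃ C : ℝ, 0 ≤ C ∧ ∀ ε ∈ Set.Ioo 0 ε₀, ∀ (x y : V) (B : ℝ),
      (∀ k ≤ 5, ∀ (ω : Boundary G o), ∀ s ∈ Set.Icc 0 (tau q),
        ‖derivS q k (a ε x ω) s‖ ≤ B * (1 + (G.dist x y : ℝ))) →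
      ‖kernel G q (a ε) x y‖ ≤ C * (1 + B) * ((q : ℝ) ^ (-(G.dist x y : ℝ) / 2) /
        (1 + (G.dist x y : ℝ)) ^ 3) := by
  -- Of the five powers, one is lost to the number of levels and one to the allowed linear growth of
  -- the derivatives, which leaves the three of the Schur kernel. The variation bound loses only the
  -- first, hence the order 4.
  obtain ⟨C, hC0, hC⟩ := exists_boundaryKernel_bound G q o 5
  obtain ⟨D, hD0, hD⟩ := ha.exists_variation_bound 4
  obtain ⟨ω₁⟩ := nonempty_boundary G q o
  refine ⟨C * (1 + D), by positivity, fun ε hε x y B hB => ?_⟩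
  have h := hC x y (a ε x) (B * (1 + (G.dist x y : ℝ))) (D / (1 + (G.dist x y : ℝ)) ^ 4)
    (by positivity) (fun ω => ha.isFlat hε x ω) (ha.continuousOn hε x) hB
    (fun ω ω' => hD ε hε x y ω ω')
  rw [kernel_eq_boundaryKernel]
  refine h.trans ?_
  have hB0 : 0 ≤ B := by
    have h1 := (norm_nonneg _).trans
      (hB 0 (by omega) ω₁ 0 ⟨le_rfl, (tau_pos hG.two_le).le⟩)
    exact nonneg_of_mul_nonneg_left h1 (by positivity)
  have hr : (0 : ℝ) < 1 + (G.dist x y : ℝ) := by positivity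
  set r := 1 + (G.dist x y : ℝ)
  set w := (q : ℝ) ^ (-(G.dist x y : ℝ) / 2)
  have hw : 0 ≤ w := by positivity
  have e : C * (w * r * (B * r / r ^ 5 + D / r ^ 4)) = C * (B + D) * (w / r ^ 3) := by
    field_simp
  rw [e]
  have h1 : C * (B + D) ≤ C * (1 + D) * (1 + B) := by
    rw [mul_assoc]
    have : 0 ≤ D * B := by positivity
    exact mul_le_mul_of_nonneg_left (by linarith) hC0
  exact mul_le_mul_of_nonneg_right h1 (by positivity)

/-- At a fixed `x`, compactness of `Ω × [0, τ]` bounds the derivatives. Rows of the kernel are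
columns of the adjoint kernel, so this puts the finitely supported functions in the domain of the
adjoint. -/
lemma IsSemiclassicalSymbol.exists_kernel_bound_row (ha : IsSemiclassicalSymbol G q ε₀ a) {ε : ℝ}
    (hε : ε ∈ Set.Ioo 0 ε₀) (x : V) : ∃ C : ℝ, ∀ y : V,
      ‖kernel G q (a ε) x y‖ ≤ C * ((q : ℝ) ^ (-(G.dist x y : ℝ) / 2) /
        (1 + (G.dist x y : ℝ)) ^ 3) := by
  obtain ⟨C, hC0, hC⟩ := ha.exists_kernel_bound
  obtain ⟨B, hB0, hB⟩ := ha.exists_deriv_bound hε x 5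
  refine ⟨C * (1 + B), fun y => hC ε hε x y B fun k hk ω s hs => (hB k hk ω s hs).trans ?_⟩
  exact le_mul_of_one_le_right hB0 (by simp)

/-- The symbol may be unbounded in `x`, but the Lipschitz condition lets its derivatives grow at
most linearly in `d(x, y)`, which `exists_kernel_bound` permits. -/
lemma IsSemiclassicalSymbol.exists_kernel_bound_column (ha : IsSemiclassicalSymbol G q ε₀ a)
    {ε : ℝ} (hε : ε ∈ Set.Ioo 0 ε₀) (y : V) : ∃ C : ℝ, ∀ x : V,
      ‖kernel G q (a ε) x y‖ ≤ C * ((q : ℝ) ^ (-(G.dist x y : ℝ) / 2) /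
        (1 + (G.dist x y : ℝ)) ^ 3) := by
  obtain ⟨C, hC0, hC⟩ := ha.exists_kernel_bound
  obtain ⟨B, hB0, hB⟩ := ha.exists_deriv_bound hε y 5
  obtain ⟨D, hD0, hD⟩ := ha.exists_lipschitz_bound 5
  have hε0 := hε.1
  refine ⟨C * (1 + (B + D * ε)), fun x => hC ε hε x y _ fun k hk ω s hs => ?_⟩
  have h1 := hD k hk ε hε x y ω s hs
  have h2 := hB k hk ω s hs
  calc ‖derivS q k (a ε x ω) s‖
      = ‖(derivS q k (a ε x ω) s - derivS q k (a ε y ω) s) + derivS q k (a ε y ω) s‖ := by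
        rw [sub_add_cancel]
    _ ≤ D * ε * (G.dist x y : ℝ) + B := (norm_add_le _ _).trans (add_le_add h1 h2)
    _ ≤ (B + D * ε) * (1 + (G.dist x y : ℝ)) := by
        have : 0 ≤ B * (G.dist x y : ℝ) := by positivity
        have : 0 ≤ D * ε := by positivity
        linarith

lemma IsSemiclassicalSymbol.exists_kernel_bound_uniform (ha : IsSemiclassicalSymbol G q ε₀ a)
    {ε : ℝ} (hε : ε ∈ Set.Ioo 0 ε₀)
    (hb : ∀ k : ℕ, ∃ B : ℝ, ∀ (x : V) (ω : Boundary G o), ∀ s ∈ Set.Icc 0 (tau q),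
      ‖derivS q k (a ε x ω) s‖ ≤ B) : ∃ C : ℝ, 0 ≤ C ∧ ∀ x y : V,
      ‖kernel G q (a ε) x y‖ ≤ C * ((q : ℝ) ^ (-(G.dist x y : ℝ) / 2) /
        (1 + (G.dist x y : ℝ)) ^ 3) := by
  obtain ⟨C, hC0, hC⟩ := ha.exists_kernel_bound
  choose B hB using hb
  have hS : 0 ≤ ∑ k ∈ Finset.range 6, |B k| := Finset.sum_nonneg fun _ _ => abs_nonneg _
  refine ⟨C * (1 + ∑ k ∈ Finset.range 6, |B k|), by positivity,
    fun x y => hC ε hε x y _ fun k hk ω s hs => (hB k x ω s hs).trans ?_⟩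
  refine ((le_abs_self _).trans (Finset.single_le_sum (f := fun k => |B k|)
    (fun _ _ => abs_nonneg _) (Finset.mem_range.2 (by omega : k < 6)))).trans ?_
  exact le_mul_of_one_le_right hS (by simp)

/-- The kernel of `Op(a)* - Op(ā)`. -/
noncomputable def remainderKernel (G : SimpleGraph V) (q : ℕ) [IsHomogeneousTree G q]
    (a : V → Boundary G o → ℝ → ℂ) (x y : V) : ℂ :=
  conj (kernel G q a y x) - kernel G q (conjSymbol a) x y

/-- After the change of base point both kernels are integrals against `ν_x` with the same
oscillating factor; only the vertex at which the symbol is taken differs. -/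
lemma IsSemiclassicalSymbol.remainderKernel_eq (ha : IsSemiclassicalSymbol G q ε₀ a) {ε : ℝ}
    (hε : ε ∈ Set.Ioo 0 ε₀) (x y : V) :
    remainderKernel G q (a ε) x y = boundaryKernel G q x y fun ω s =>
      conjSymbol (a ε) y ω s - conjSymbol (a ε) x ω s := by
  rw [remainderKernel, kernel_eq_boundaryKernel, kernel_eq_boundaryKernel, conj_boundaryKernel]
  exact boundaryKernel_sub x y (ha.conj.continuousOn hε y) (ha.conj.continuousOn hε x)

/-- A uniform bound and a bound of order `ε` for the kernel of `Op(a)* - Op(ā)`. -/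
lemma IsSemiclassicalSymbol.exists_remainderKernel_bound (ha : IsSemiclassicalSymbol G q ε₀ a)
    (N : ℕ) : ∃ C : ℝ, 0 ≤ C ∧ ∀ ε ∈ Set.Ioo 0 ε₀, ∀ x y : V,
      ‖remainderKernel G q (a ε) x y‖ ≤
        C * ε * ((q : ℝ) ^ (-(G.dist x y : ℝ) / 2) * (1 + (G.dist x y : ℝ)) ^ 2) ∧
      ‖remainderKernel G q (a ε) x y‖ ≤
        C * ((q : ℝ) ^ (-(G.dist x y : ℝ) / 2) / (1 + (G.dist x y : ℝ)) ^ N) := by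
  have ha' := ha.conj
  obtain ⟨C₀, hC₀, h₀⟩ := exists_boundaryKernel_bound G q o 0
  obtain ⟨C₁, hC₁, h₁⟩ := exists_boundaryKernel_bound G q o (N + 2)
  obtain ⟨L, hL, hLip⟩ := ha'.exists_lipschitz_bound (N + 2)
  obtain ⟨D, hD, hvar⟩ := ha'.exists_variation_bound (N + 1)
  refine ⟨max (C₀ * (3 * L)) (C₁ * (L * |ε₀| + 2 * D)), le_max_of_le_left (by positivity),
    fun ε hε x y => ?_⟩
  have hε0 := hε.1
  have hεε : ε ≤ |ε₀| := hε.2.le.trans (le_abs_self _)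
  have hflat : ∀ ω, IsFlat (tau q) fun s => conjSymbol (a ε) y ω s - conjSymbol (a ε) x ω s :=
    fun ω => (IsFlat.sub hG.two_le (ha'.isFlat hε y ω) (ha'.isFlat hε x ω)).1
  have hcont := (ha'.continuousOn hε y).sub (ha'.continuousOn hε x)
  have hder : ∀ k ≤ N + 2, ∀ ω, ∀ s ∈ Set.Icc 0 (tau q),
      ‖derivS q k (fun s => conjSymbol (a ε) y ω s - conjSymbol (a ε) x ω s) s‖ ≤
        L * ε * (G.dist x y : ℝ) := by
    intro k hk ω s hs
    rw [(IsFlat.sub hG.two_le (ha'.isFlat hε y ω) (ha'.isFlat hε x ω)).2 k s hs, G.dist_comm]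
    exact hLip k hk ε hε y x ω s hs
  have hr : (0 : ℝ) < 1 + (G.dist x y : ℝ) := by positivity
  have hdr : (G.dist x y : ℝ) ≤ 1 + (G.dist x y : ℝ) := by linarith
  rw [ha.remainderKernel_eq hε]
  constructor
  -- No decay is required here, so the variation in `ω` is bounded by twice the supremum; together
  -- with the supremum itself this gives `3 * L`.
  · have h := h₀ x y _ (L * ε * (G.dist x y : ℝ)) (2 * (L * ε * (G.dist x y : ℝ))) (by positivity)
      hflat hcont (fun k hk => hder k (by omega)) (fun ω ω' _ _ s hs => by
        have e1 := hder 0 (by omega) ω s hs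
        have e2 := hder 0 (by omega) ω' s hs
        simp only [derivS, iteratedDerivWithin_zero] at e1 e2
        exact (norm_sub_le _ _).trans (by linarith))
    refine h.trans ?_
    set r := 1 + (G.dist x y : ℝ)
    set w := (q : ℝ) ^ (-(G.dist x y : ℝ) / 2)
    have hw : 0 ≤ w := by positivity
    calc C₀ * (w * r * (L * ε * (G.dist x y : ℝ) / r ^ 0 + 2 * (L * ε * (G.dist x y : ℝ))))
        = C₀ * (3 * L) * ε * (w * r * (G.dist x y : ℝ)) := by ring
      _ ≤ max (C₀ * (3 * L)) (C₁ * (L * |ε₀| + 2 * D)) * ε * (w * r * r) := by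
          gcongr
          exact le_max_left _ _
      _ = _ := by ring
  -- The variations at `x` and at `y` are bounded separately. The middle set of boundary points is
  -- symmetric in `x` and `y`, so the same bound serves for both ends.
  · have h := h₁ x y _ (L * ε * (G.dist x y : ℝ)) (2 * (D / (1 + (G.dist x y : ℝ)) ^ (N + 1)))
      (by positivity) hflat hcont hder (fun ω ω' hω hω' s hs => by
        have e1 := hvar ε hε x y ω ω' hω hω' s hs
        have e2 := hvar ε hε y x ω ω' (by rwa [abs_sub_comm, G.dist_comm])
          (by rwa [abs_sub_comm, G.dist_comm]) s hs
        rw [G.dist_comm (u := y)] at e2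
        rw [sub_sub_sub_comm]
        exact (norm_sub_le _ _).trans (by linarith))
    refine h.trans ?_
    set r := 1 + (G.dist x y : ℝ)
    set w := (q : ℝ) ^ (-(G.dist x y : ℝ) / 2)
    have hw : 0 ≤ w := by positivity
    calc C₁ * (w * r * (L * ε * (G.dist x y : ℝ) / r ^ (N + 2) + 2 * (D / r ^ (N + 1))))
        ≤ C₁ * (w * r * (L * |ε₀| * r / r ^ (N + 2) + 2 * (D / r ^ (N + 1)))) := by gcongr
      _ = C₁ * (L * |ε₀| + 2 * D) * (w / r ^ N) := by
          rw [pow_succ, pow_succ]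
          field_simp
      _ ≤ _ := by
          gcongr
          exact le_max_right _ _

/-- Geometric mean of the two preceding bounds: one is small in `ε` without sufficient decay, the
other decays without being small. -/
lemma IsSemiclassicalSymbol.exists_remainderKernel_sqrt_bound
    (ha : IsSemiclassicalSymbol G q ε₀ a) (N : ℕ) : ∃ C : ℝ, 0 ≤ C ∧ ∀ ε ∈ Set.Ioo 0 ε₀,
      ∀ x y : V, ‖remainderKernel G q (a ε) x y‖ ≤
        C * √ε * ((q : ℝ) ^ (-(G.dist x y : ℝ) / 2) / (1 + (G.dist x y : ℝ)) ^ N) := by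
  -- The product of the bounds then carries `(1 + d)^(2 - (2N + 2))`, the square of the required
  -- power.
  obtain ⟨C, hC, h⟩ := ha.exists_remainderKernel_bound (2 * N + 2)
  refine ⟨C, hC, fun ε hε x y => ?_⟩
  obtain ⟨h1, h2⟩ := h ε hε x y
  have hε0 := hε.1
  refine le_of_sq_le_sq ?_ (by positivity)
  rw [sq]
  refine (mul_le_mul h1 h2 (norm_nonneg _) (by positivity)).trans (le_of_eq ?_)
  rw [mul_pow, mul_pow, Real.sq_sqrt hε0.le, div_pow, ← pow_mul, pow_add, mul_comm N 2]
  field_simp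

end SymbolEstimates

/-! ### The Schur test -/

section Schur

variable {V : Type*}

/-- Nonnegative symmetric kernels which satisfy the hypothesis of the Schur test. -/
structure IsSchurKernel (κ : V → V → ℝ) (A : ℝ) : Prop where
  nonneg : ∀ x y, 0 ≤ κ x y
  symm : ∀ x y, κ x y = κ y x
  exists_weight : ∃ p : V → ℝ, (∀ x, 0 < p x) ∧
    ∀ (x : V) (F : Finset V), ∑ y ∈ F, κ x y * p y ≤ A * p x

variable {κ : V → V → ℝ} {A : ℝ} {K : V → V → ℂ}

/-- Cauchy–Schwarz with the splitting `κ|u| = √(κp) · √(κ|u|²/p)`; the sums are then exchanged and,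
by symmetry of `κ`, the weight condition is used a second time. With finite sums only, no
summability has to be discussed. -/
lemma IsSchurKernel.sum_sq_le (hκ : IsSchurKernel κ A) {C : ℝ}
    (hK : ∀ x y, ‖K x y‖ ≤ C * κ x y) (u : V → ℂ) (E F : Finset V) :
    ∑ x ∈ E, ‖∑ y ∈ F, K x y * u y‖ ^ 2 ≤ (C * A) ^ 2 * ∑ y ∈ F, ‖u y‖ ^ 2 := by
  obtain ⟨p, hp, hA⟩ := hκ.exists_weight
  have hg : ∀ x y, 0 ≤ κ x y * (‖u y‖ ^ 2 / p y) := fun x y =>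
    mul_nonneg (hκ.nonneg x y) (div_nonneg (by positivity) (hp y).le)
  have h1 : ∀ x, ‖∑ y ∈ F, K x y * u y‖ ^ 2 ≤
      C ^ 2 * (A * p x * ∑ y ∈ F, κ x y * (‖u y‖ ^ 2 / p y)) := by
    intro x
    have e1 : ‖∑ y ∈ F, K x y * u y‖ ≤ C * ∑ y ∈ F, κ x y * ‖u y‖ := by
      rw [Finset.mul_sum]
      refine norm_sum_le_of_le _ fun y _ => ?_
      rw [norm_mul, ← mul_assoc]
      exact mul_le_mul_of_nonneg_right (hK x y) (norm_nonneg _)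
    have e2 : (∑ y ∈ F, κ x y * ‖u y‖) ^ 2 ≤
        (∑ y ∈ F, κ x y * p y) * ∑ y ∈ F, κ x y * (‖u y‖ ^ 2 / p y) := by
      refine Finset.sum_sq_le_sum_mul_sum_of_sq_le_mul F
        (fun y _ => mul_nonneg (hκ.nonneg x y) (hp y).le) (fun y _ => hg x y) fun y _ => ?_
      have := (hp y).ne'
      refine le_of_eq ?_
      field_simp
    calc ‖∑ y ∈ F, K x y * u y‖ ^ 2 ≤ (C * ∑ y ∈ F, κ x y * ‖u y‖) ^ 2 := by gcongr
      _ = C ^ 2 * (∑ y ∈ F, κ x y * ‖u y‖) ^ 2 := by ring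
      _ ≤ C ^ 2 * (A * p x * ∑ y ∈ F, κ x y * (‖u y‖ ^ 2 / p y)) := by
          refine mul_le_mul_of_nonneg_left (e2.trans ?_) (by positivity)
          exact mul_le_mul_of_nonneg_right (hA x F) (Finset.sum_nonneg fun y _ => hg x y)
  calc ∑ x ∈ E, ‖∑ y ∈ F, K x y * u y‖ ^ 2
      ≤ ∑ x ∈ E, C ^ 2 * (A * p x * ∑ y ∈ F, κ x y * (‖u y‖ ^ 2 / p y)) :=
        Finset.sum_le_sum fun x _ => h1 x
    _ = ∑ y ∈ F, C ^ 2 * A * (‖u y‖ ^ 2 / p y) * ∑ x ∈ E, κ y x * p x := by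
        simp only [Finset.mul_sum]
        rw [Finset.sum_comm]
        refine Finset.sum_congr rfl fun y _ => Finset.sum_congr rfl fun x _ => ?_
        rw [hκ.symm x y]
        ring
    _ ≤ ∑ y ∈ F, (C * A) ^ 2 * ‖u y‖ ^ 2 := by
        refine Finset.sum_le_sum fun y _ => ?_
        have hy := hp y
        have hA0 : 0 ≤ A := by
          have := hA y ∅
          rw [Finset.sum_empty] at this
          exact nonneg_of_mul_nonneg_left this hy
        calc C ^ 2 * A * (‖u y‖ ^ 2 / p y) * ∑ x ∈ E, κ y x * p x
            ≤ C ^ 2 * A * (‖u y‖ ^ 2 / p y) * (A * p y) := by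
              gcongr
              exact hA y E
          _ = (C * A) ^ 2 * ‖u y‖ ^ 2 := by
              field_simp
    _ = _ := by rw [Finset.mul_sum]

lemma applyKernel_eq_sum (K : V → V → ℂ) {u : V → ℂ} (hu : (Function.support u).Finite) (x : V) :
    applyKernel K u x = ∑ y ∈ hu.toFinset, K x y * u y := by
  refine finsum_eq_sum_of_support_subset _ fun y hy => ?_
  simp only [Set.Finite.coe_toFinset, Function.mem_support]
  exact fun h => hy (by simp [h])

lemma IsSchurKernel.memℓp_applyKernel (hκ : IsSchurKernel κ A)
    (hK : ∀ y, ∃ C : ℝ, ∀ x, ‖K x y‖ ≤ C * κ x y) {u : V → ℂ}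
    (hu : (Function.support u).Finite) : Memℓp (E := fun _ : V => ℂ) (applyKernel K u) 2 := by
  classical
  choose C hC using hK
  set F := hu.toFinset with hF
  have hS : 0 ≤ ∑ y ∈ F, |C y| := Finset.sum_nonneg fun _ _ => abs_nonneg _
  -- Column bounds are not uniform, but only the finitely many columns in the support of `u` matter;
  -- the kernel is set to 0 on the others.
  have h := hκ.sum_sq_le (K := fun x y => if y ∈ F then K x y else 0) (C := ∑ y ∈ F, |C y|) (by
    intro x y
    split_ifs with hy
    · exact (hC y x).trans (mul_le_mul_of_nonneg_right ((le_abs_self _).trans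
        (Finset.single_le_sum (f := fun y => |C y|) (fun _ _ => abs_nonneg _) hy)) (hκ.nonneg x y))
    · rw [norm_zero]
      exact mul_nonneg hS (hκ.nonneg x y)) u
  refine memℓp_gen' fun E => le_trans (le_of_eq ?_) (h E F)
  refine Finset.sum_congr rfl fun x _ => ?_
  rw [applyKernel_eq_sum K hu, ENNReal.toReal_ofNat, Real.rpow_two]
  congr 2
  exact Finset.sum_congr rfl fun y hy => by rw [if_pos hy]

lemma lp_norm_sq_eq_sum {u : L2 V} (hu : (Function.support (u : V → ℂ)).Finite) :
    ‖u‖ ^ 2 = ∑ y ∈ hu.toFinset, ‖u y‖ ^ 2 := by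
  have h := lp.norm_rpow_eq_tsum (p := 2) (by simp) u
  simp only [ENNReal.toReal_ofNat, Real.rpow_two] at h
  rw [h]
  refine tsum_eq_sum fun y hy => ?_
  simp only [Set.Finite.mem_toFinset, Function.mem_support, not_not] at hy
  simp [hy]

lemma IsSchurKernel.norm_applyKernel_le (hκ : IsSchurKernel κ A) (hA : 0 ≤ A) {C : ℝ} (hC : 0 ≤ C)
    (hK : ∀ x y, ‖K x y‖ ≤ C * κ x y) {u v : L2 V} (hu : (Function.support (u : V → ℂ)).Finite)
    (hv : (v : V → ℂ) = applyKernel K u) : ‖v‖ ≤ C * A * ‖u‖ := by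
  refine lp.norm_le_of_forall_sum_le (p := 2) (by simp) (by positivity) fun E => ?_
  simp only [ENNReal.toReal_ofNat, Real.rpow_two]
  rw [mul_pow, lp_norm_sq_eq_sum hu]
  refine le_trans (le_of_eq (Finset.sum_congr rfl fun x _ => ?_)) (hκ.sum_sq_le hK u E _)
  rw [hv, applyKernel_eq_sum K hu]

end Schur

/-! ### Operators defined by kernels -/

section Operators

variable {V : Type*} {κ : V → V → ℝ} {A : ℝ} {K : V → V → ℂ}

lemma dense_finSupp : Dense (finSupp V : Set (L2 V)) := by
  classical
  intro u
  refine mem_closure_of_tendsto (lp.hasSum_single (p := 2) (by simp) u)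
    (Eventually.of_forall fun s => ?_)
  refine Submodule.sum_mem _ fun y _ => ?_
  refine (Set.finite_singleton y).subset fun x hx => ?_
  by_contra hne
  exact hx (lp.single_apply_ne 2 y _ hne)

lemma domain_kernelOperator (hκ : IsSchurKernel κ A)
    (hK : ∀ y, ∃ C : ℝ, ∀ x, ‖K x y‖ ≤ C * κ x y) : (kernelOperator K).domain = finSupp V :=
  le_antisymm (fun _ hu => hu.1) fun _ hu => ⟨hu, hκ.memℓp_applyKernel hK hu⟩

lemma exists_boundedExtension (hκ : IsSchurKernel κ A) (hA : 0 ≤ A) {C : ℝ} (hC : 0 ≤ C)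
    (hK : ∀ x y, ‖K x y‖ ≤ C * κ x y) :
    ∃ T : L2 V →L[ℂ] L2 V, IsBoundedExtension (kernelOperator K) T ∧ ‖T‖ ≤ C * A := by
  have hdom := domain_kernelOperator hκ fun y => ⟨C, fun x => hK x y⟩
  have hdense : DenseRange (kernelOperator K).domain.subtype := by
    rw [hdom]
    exact dense_finSupp.denseRange_val
  have hbound : ∀ u : (kernelOperator K).domain,
      ‖(kernelOperator K).toFun u‖ ≤ C * A * ‖(kernelOperator K).domain.subtype u‖ := fun u =>
    hκ.norm_applyKernel_le hA hC hK u.2.1 rfl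
  exact ⟨(kernelOperator K).toFun.extendOfNorm (kernelOperator K).domain.subtype,
    fun u => LinearMap.extendOfNorm_eq hdense ⟨_, hbound⟩ u,
    LinearMap.opNorm_extendOfNorm_le hdense (by positivity) hbound⟩

lemma isFormalAdjoint_kernelOperator (K : V → V → ℂ) :
    (kernelOperator K).IsFormalAdjoint (kernelOperator fun x y => conj (K y x)) := by
  intro u v
  have hu : (Function.support ((u : L2 V) : V → ℂ)).Finite := u.2.1
  have hv : (Function.support ((v : L2 V) : V → ℂ)).Finite := v.2.1
  have h1 : ∀ x, ((kernelOperator K u : L2 V) : V → ℂ) x = applyKernel K (u : L2 V) x :=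
    fun x => rfl
  have h2 : ∀ x, ((kernelOperator (fun x y => conj (K y x)) v : L2 V) : V → ℂ) x =
      applyKernel (fun x y => conj (K y x)) (v : L2 V) x := fun x => rfl
  rw [lp.inner_eq_tsum, lp.inner_eq_tsum, tsum_eq_sum (s := hv.toFinset),
    tsum_eq_sum (s := hu.toFinset)]
  · simp only [h1, h2, applyKernel_eq_sum _ hu, applyKernel_eq_sum _ hv, RCLike.inner_apply,
      map_sum, map_mul, Finset.mul_sum, Finset.sum_mul]
    rw [Finset.sum_comm]
    exact Finset.sum_congr rfl fun y _ => Finset.sum_congr rfl fun x _ => by ring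
  · intro y hy
    simp only [Set.Finite.mem_toFinset, Function.mem_support, not_not] at hy
    simp [hy]
  · intro y hy
    simp only [Set.Finite.mem_toFinset, Function.mem_support, not_not] at hy
    simp [hy]

/-- The adjoint of an operator with a kernel is, on finitely supported functions, the operator with
the adjoint kernel. -/
lemma adjoint_sub_kernelOperator (hκ : IsSchurKernel κ A) {K K' : V → V → ℂ}
    (hcol : ∀ y, ∃ C : ℝ, ∀ x, ‖K x y‖ ≤ C * κ x y) (hrow : ∀ x, ∃ C : ℝ, ∀ y, ‖K x y‖ ≤ C * κ x y)
    (hcol' : ∀ y, ∃ C : ℝ, ∀ x, ‖K' x y‖ ≤ C * κ x y) :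
    (kernelOperator K).adjoint - kernelOperator K' =
      kernelOperator (fun x y => conj (K y x) - K' x y) := by
  have hstar : ∀ y, ∃ C : ℝ, ∀ x, ‖conj (K y x)‖ ≤ C * κ x y := fun y => by
    obtain ⟨C, hC⟩ := hrow y
    exact ⟨C, fun x => by rw [RCLike.norm_conj, hκ.symm]; exact hC x⟩
  have hdiff : ∀ y, ∃ C : ℝ, ∀ x, ‖conj (K y x) - K' x y‖ ≤ C * κ x y := fun y => by
    obtain ⟨C, hC⟩ := hstar y
    obtain ⟨C', hC'⟩ := hcol' y
    exact ⟨C + C', fun x => by rw [add_mul]; exact (norm_sub_le _ _).trans (add_le_add (hC x) (hC' x))⟩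
  have hdense : Dense ((kernelOperator K).domain : Set (L2 V)) := by
    rw [domain_kernelOperator hκ hcol]
    exact dense_finSupp
  have hle := (isFormalAdjoint_kernelOperator K).le_adjoint hdense
  have hdom := domain_kernelOperator hκ hstar
  have hdom' := domain_kernelOperator hκ hcol'
  have hdomd := domain_kernelOperator hκ hdiff
  refine LinearPMap.ext ?_ ?_
  · rw [LinearPMap.sub_domain, hdom', hdomd]
    -- The domain of the adjoint may be larger; the domain of the difference is its intersection
    -- with the finitely supported functions.
    exact inf_eq_right.2 (hdom.symm.le.trans hle.1)
  · intro u hu hu'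
    have huf : (Function.support (u : V → ℂ)).Finite := hu'.1
    have hus : u ∈ (kernelOperator fun x y => conj (K y x)).domain := by rw [hdom]; exact huf
    rw [LinearPMap.sub_apply, ← hle.2 (x := ⟨u, hus⟩) (y := ⟨u, hu.1⟩) rfl]
    refine lp.ext (funext fun x => ?_)
    rw [lp.coeFn_sub, Pi.sub_apply]
    change applyKernel (fun x y => conj (K y x)) u x - applyKernel K' u x =
      applyKernel (fun x y => conj (K y x) - K' x y) u x
    rw [applyKernel_eq_sum _ huf, applyKernel_eq_sum _ huf, applyKernel_eq_sum _ huf,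
      ← Finset.sum_sub_distrib]
    exact Finset.sum_congr rfl fun y _ => by rw [sub_mul]

/-- The bounded extension of `T* - S` is the difference of the adjoint of the extension of `T` and
the extension of `S`. -/
lemma adjoint_sub_eq_of_isBoundedExtension {T S : L2 V →ₗ.[ℂ] L2 V} {T' S' R : L2 V →L[ℂ] L2 V}
    (hT : IsBoundedExtension T T') (hS : IsBoundedExtension S S')
    (hR : IsBoundedExtension (T.adjoint - S) R) (hdT : Dense (T.domain : Set (L2 V)))
    (hd : Dense ((T.adjoint - S).domain : Set (L2 V))) :
    ContinuousLinearMap.adjoint T' - S' = R := by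
  refine ContinuousLinearMap.ext fun v => ?_
  refine congrFun (Continuous.ext_on hd (ContinuousLinearMap.continuous _)
    (ContinuousLinearMap.continuous _) fun u hu => ?_) v
  have h1 := hR ⟨u, hu⟩
  rw [LinearPMap.sub_apply, ← hS ⟨u, hu.2⟩] at h1
  rw [h1, _root_.sub_apply]
  congr 1
  refine (LinearPMap.adjoint_apply_eq hdT ⟨u, hu.1⟩ fun x => ?_).symm
  rw [ContinuousLinearMap.adjoint_inner_left, hT x]

end Operators

/-! ### The weight on the tree -/

section TreeWeight

variable {q : ℕ} {V : Type*} {G : SimpleGraph V}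

/-- The cylinders of the points of a sphere are disjoint and of equal known mass, and the total mass
is at most 1. -/
lemma card_sphere_le [hG : IsHomogeneousTree G q] (z : V) (m : ℕ) (F : Finset V)
    (hF : ∀ y ∈ F, G.dist z y = m) : (F.card : ℝ) ≤ 2 * (q : ℝ) ^ m := by
  have hq := two_le_real hG
  have hT := hG.isTree
  rcases m with _ | m
  · have h1 : F.card ≤ 1 := Finset.card_le_one.2 fun y hy y' hy' => by
      rw [← hT.connected.dist_eq_zero_iff.1 (hF y hy), ← hT.connected.dist_eq_zero_iff.1 (hF y' hy')]
    have : (F.card : ℝ) ≤ 1 := by exact_mod_cast h1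
    simp only [pow_zero]
    linarith
  · have hd : Set.PairwiseDisjoint (F : Set V) fun y => cylinder G z z y := by
      intro y hy y' hy' hne
      refine Set.disjoint_left.2 fun ω h h' => hne ?_
      exact eq_of_mem_cylinder hT h h' (by rw [hF y hy, hF y' hy'])
    have h1 := measureReal_biUnion_finset (μ := boundaryMeasure G q z z) hd
      fun y _ => measurableSet_cylinder z y
    rw [Finset.sum_congr rfl fun y hy => measureReal_cylinder (hF y hy), Finset.sum_const,
      nsmul_eq_mul] at h1
    have h2 : (F.card : ℝ) * (((q : ℝ) + 1) * (q : ℝ) ^ m)⁻¹ ≤ 1 := h1 ▸ measureReal_le_one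
    rw [← div_eq_mul_inv, div_le_one (by positivity)] at h2
    refine h2.trans ?_
    rw [pow_succ]
    have : 0 ≤ (q : ℝ) ^ m := by positivity
    nlinarith

/-- The kernel `q^{-d(x,y)/2} (1 + d(x,y))⁻³`. -/
noncomputable def decayKernel (G : SimpleGraph V) (q : ℕ) (x y : V) : ℝ :=
  (q : ℝ) ^ (-(G.dist x y : ℝ) / 2) / (1 + (G.dist x y : ℝ)) ^ 3

/-- The weight is `p(x) = q^{h_ω(x)/2}` for a fixed `ω`. Sort the `y` by `n = d(x, y)` and by the
number `j` of edges shared by `[x, y]` and `[x, ω)`. Such a class has at most `2 q^{n-j}` members,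
while `q^{-n/2} p(y) = q^{-(n-j)} p(x)`, so it contributes at most `2 (1 + n)^{-3} p(x)`. The `n +
1` values of `j` leave the summable series of `2 (1 + n)^{-2}`. -/
lemma isSchurKernel_decayKernel (G : SimpleGraph V) (q : ℕ) [hG : IsHomogeneousTree G q] (o : V) :
    ∃ A : ℝ, 0 ≤ A ∧ IsSchurKernel (decayKernel G q) A := by
  classical
  have hq : (0 : ℝ) < q := by linarith [two_le_real hG]
  have hT := hG.isTree
  obtain ⟨ω⟩ := nonempty_boundary G q o
  have hsum : Summable fun n : ℕ => 2 * (1 / ((n : ℝ) + 1) ^ 2) := by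
    refine Summable.mul_left 2 ?_
    have := (summable_nat_add_iff (f := fun n : ℕ => 1 / (n : ℝ) ^ 2) 1).2
      (Real.summable_one_div_nat_pow.2 (by norm_num))
    simpa using this
  refine ⟨∑' n : ℕ, 2 * (1 / ((n : ℝ) + 1) ^ 2), tsum_nonneg fun n => by positivity,
    fun x y => by unfold decayKernel; positivity, fun x y => by rw [decayKernel, decayKernel,
    G.dist_comm], fun x => (q : ℝ) ^ ((height G ω x : ℝ) / 2), fun x => by positivity,
    fun x F => ?_⟩
  choose k hk hH using fun y => exists_height_sub hT ω x y
  let t : Finset (Σ _ : ℕ, ℕ) := (Finset.range (F.sup (G.dist x) + 1)).sigma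
    fun n => Finset.range (n + 1)
  have hmaps : ∀ y ∈ F, (⟨G.dist x y, k y⟩ : Σ _ : ℕ, ℕ) ∈ t := by
    intro y hy
    rw [Finset.mem_sigma]
    exact ⟨Finset.mem_range.2 (Nat.lt_succ_of_le (Finset.le_sup (f := G.dist x) hy)),
      Finset.mem_range.2 (Nat.lt_succ_of_le (hk y))⟩
  rw [← Finset.sum_fiberwise_of_maps_to hmaps, Finset.sum_sigma]
  have hterm : ∀ n : ℕ, ∀ j ∈ Finset.range (n + 1),
      ∑ y ∈ F with (⟨G.dist x y, k y⟩ : Σ _ : ℕ, ℕ) = ⟨n, j⟩,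
        decayKernel G q x y * (q : ℝ) ^ ((height G ω y : ℝ) / 2) ≤
      2 * (1 / (1 + (n : ℝ)) ^ 3) * (q : ℝ) ^ ((height G ω x : ℝ) / 2) := by
    intro n j hj
    have hj' : j ≤ n := Nat.lt_succ_iff.1 (Finset.mem_range.1 hj)
    have hfib : ∀ y ∈ F.filter (fun y => (⟨G.dist x y, k y⟩ : Σ _ : ℕ, ℕ) = ⟨n, j⟩),
        G.dist x y = n ∧ k y = j := by
      intro y hy
      have := (Finset.mem_filter.1 hy).2
      simpa using this
    -- All `y` of the class lie on one sphere: its centre is the `j`-th point `z` of `[x, ω)` and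
    -- its radius is `n - j`.
    obtain ⟨z, hz, hωz⟩ := exists_mem_cylinder hT ω x j
    have hcard := card_sphere_le (G := G) (q := q) z (n - j)
      (F.filter (fun y => (⟨G.dist x y, k y⟩ : Σ _ : ℕ, ℕ) = ⟨n, j⟩)) (by
      intro y hy
      obtain ⟨h1, h2⟩ := hfib y hy
      obtain ⟨v, hv, hb⟩ := exists_between hT x y (n := j) (by omega)
      have h3 : ω ∈ cylinder G o x v := by
        rw [mem_cylinder_iff_height hT hb, hH y, hv, h2]
      obtain rfl := eq_of_mem_cylinder hT hωz h3 (by omega)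
      omega)
    have hval : ∀ y ∈ F.filter (fun y => (⟨G.dist x y, k y⟩ : Σ _ : ℕ, ℕ) = ⟨n, j⟩),
        decayKernel G q x y * (q : ℝ) ^ ((height G ω y : ℝ) / 2) =
          ((q : ℝ) ^ (n - j))⁻¹ * (1 / (1 + (n : ℝ)) ^ 3) *
            (q : ℝ) ^ ((height G ω x : ℝ) / 2) := by
      intro y hy
      obtain ⟨h1, h2⟩ := hfib y hy
      have h3 := hH y
      rw [h1, h2] at h3
      have h4 : (height G ω y : ℝ) = height G ω x + (2 * (j : ℝ) - n) := by
        have : height G ω y = height G ω x + (2 * (j : ℤ) - n) := by omega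
        exact_mod_cast this
      have h5 : (q : ℝ) ^ (-(n : ℝ) / 2) * (q : ℝ) ^ ((height G ω y : ℝ) / 2) =
          ((q : ℝ) ^ (n - j))⁻¹ * (q : ℝ) ^ ((height G ω x : ℝ) / 2) := by
        rw [← Real.rpow_natCast, ← Real.rpow_neg hq.le, ← Real.rpow_add hq, ← Real.rpow_add hq, h4,
          Nat.cast_sub hj']
        congr 1
        ring
      rw [decayKernel, h1]
      linear_combination (1 / (1 + (n : ℝ)) ^ 3) * h5
    rw [Finset.sum_congr rfl hval, Finset.sum_const, nsmul_eq_mul]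
    have hqn : (0 : ℝ) < (q : ℝ) ^ (n - j) := by positivity
    calc _ ≤ 2 * (q : ℝ) ^ (n - j) * (((q : ℝ) ^ (n - j))⁻¹ * (1 / (1 + (n : ℝ)) ^ 3) *
            (q : ℝ) ^ ((height G ω x : ℝ) / 2)) := by gcongr
      _ = _ := by field_simp
  calc _ ≤ ∑ n ∈ Finset.range (F.sup (G.dist x) + 1), ∑ j ∈ Finset.range (n + 1),
        2 * (1 / (1 + (n : ℝ)) ^ 3) * (q : ℝ) ^ ((height G ω x : ℝ) / 2) :=
        Finset.sum_le_sum fun n _ => Finset.sum_le_sum fun j hj => hterm n j hj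
    _ = (∑ n ∈ Finset.range (F.sup (G.dist x) + 1), 2 * (1 / ((n : ℝ) + 1) ^ 2)) *
          (q : ℝ) ^ ((height G ω x : ℝ) / 2) := by
        rw [Finset.sum_mul]
        refine Finset.sum_congr rfl fun n _ => ?_
        rw [Finset.sum_const, Finset.card_range, nsmul_eq_mul]
        push_cast
        field_simp
        ring
    _ ≤ _ := by
        gcongr
        exact hsum.sum_le_tsum _ fun n _ => by positivity

end TreeWeight

end TreePDO

/-! ### Proof of the theorem -/

open TreePDO

theorem mainTheorem3 {V : Type*} (G : SimpleGraph V) (q : ℕ) [TreePDO.IsHomogeneousTree G q]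
    (o : V) (ε₀ : ℝ) (hε₀ : 0 < ε₀) (a : ℝ → V → TreePDO.Boundary G o → ℝ → ℂ)
    (ha : TreePDO.IsSemiclassicalSymbol G q ε₀ a) :
    -- `Op(a)` and `Op(a)* - Op(ā)` are defined on the finitely supported functions
    (∀ ε ∈ Set.Ioo 0 ε₀,
      (TreePDO.Op G q (a ε)).domain = TreePDO.finSupp V ∧
      ((TreePDO.Op G q (a ε)).adjoint - TreePDO.Op G q (TreePDO.conjSymbol (a ε))).domain =
        TreePDO.finSupp V) ∧
    -- `Op(a)* - Op(ā)` is negligible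
    TreePDO.IsNegligible G q ε₀
      (fun ε => (TreePDO.Op G q (a ε)).adjoint - TreePDO.Op G q (TreePDO.conjSymbol (a ε))) ∧
    -- `Op(a)* - Op(ā)` is bounded on `L²` and its norm tends to `0`
    ∃ R : ℝ → (TreePDO.L2 V →L[ℂ] TreePDO.L2 V),
      (∀ ε ∈ Set.Ioo 0 ε₀,
        TreePDO.IsBoundedExtension
          ((TreePDO.Op G q (a ε)).adjoint - TreePDO.Op G q (TreePDO.conjSymbol (a ε))) (R ε)) ∧
      Tendsto (fun ε => ‖R ε‖) (𝓝[>] 0) (𝓝 0) ∧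
      -- if the symbol is bounded, `Op(a)` and `Op(ā)` themselves extend to bounded operators
      (∀ ε ∈ Set.Ioo 0 ε₀,
        (∀ k : ℕ, ∃ B : ℝ, ∀ (x : V) (ω : TreePDO.Boundary G o),
          ∀ s ∈ Set.Icc 0 (TreePDO.tau q), ‖TreePDO.derivS q k (a ε x ω) s‖ ≤ B) →
        ∃ A A' : TreePDO.L2 V →L[ℂ] TreePDO.L2 V,
          TreePDO.IsBoundedExtension (TreePDO.Op G q (a ε)) A ∧
          TreePDO.IsBoundedExtension (TreePDO.Op G q (TreePDO.conjSymbol (a ε))) A' ∧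
          ContinuousLinearMap.adjoint A - A' = R ε) := by
  have hq : 2 ≤ q := (‹IsHomogeneousTree G q› : IsHomogeneousTree G q).two_le
  obtain ⟨S, hS, hκ⟩ := isSchurKernel_decayKernel G q o
  have hop : ∀ ε ∈ Set.Ioo 0 ε₀, (Op G q (a ε)).domain = finSupp V := fun ε hε =>
    domain_kernelOperator hκ (ha.exists_kernel_bound_column hε)
  have hrem : ∀ ε ∈ Set.Ioo 0 ε₀, (Op G q (a ε)).adjoint - Op G q (conjSymbol (a ε)) =
      kernelOperator (remainderKernel G q (a ε)) := fun ε hε =>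
    adjoint_sub_kernelOperator hκ (ha.exists_kernel_bound_column hε)
      (ha.exists_kernel_bound_row hε) (ha.conj.exists_kernel_bound_column hε)
  have hsqrt : ∀ C : ℝ, Tendsto (fun ε => C * √ε) (𝓝[>] 0) (𝓝 0) := fun C => by
    have : Tendsto (fun ε => C * √ε) (𝓝 0) (𝓝 (C * √0)) :=
      (continuous_const.mul Real.continuous_sqrt).tendsto 0
    rw [Real.sqrt_zero, mul_zero] at this
    exact this.mono_left nhdsWithin_le_nhds
  -- Decay of order 3 is that of `decayKernel`, as the Schur test requires.
  obtain ⟨C, hC, hbound⟩ := ha.exists_remainderKernel_sqrt_bound 3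
  have hdom : ∀ ε ∈ Set.Ioo 0 ε₀,
      ((Op G q (a ε)).adjoint - Op G q (conjSymbol (a ε))).domain = finSupp V := fun ε hε => by
    rw [hrem ε hε]
    exact domain_kernelOperator hκ fun y => ⟨C * √ε, fun x => hbound ε hε x y⟩
  have hext : ∀ ε, ∃ T : L2 V →L[ℂ] L2 V, ε ∈ Set.Ioo 0 ε₀ →
      IsBoundedExtension ((Op G q (a ε)).adjoint - Op G q (conjSymbol (a ε))) T ∧
        ‖T‖ ≤ C * √ε * S := by
    intro ε
    by_cases hε : ε ∈ Set.Ioo 0 ε₀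
    · obtain ⟨T, hT⟩ := exists_boundedExtension hκ hS (C := C * √ε) (by positivity) (hbound ε hε)
      exact ⟨T, fun _ => by rwa [hrem ε hε]⟩
    -- Outside `(0, ε₀)` the value of `R` is irrelevant.
    · exact ⟨0, fun h => absurd h hε⟩
  choose R hR using hext
  refine ⟨fun ε hε => ⟨hop ε hε, hdom ε hε⟩, ⟨fun ε => remainderKernel G q (a ε), hrem, fun N => ?_⟩,
    R, fun ε hε => (hR ε hε).1, ?_, fun ε hε hb => ?_⟩
  · obtain ⟨C, -, hC⟩ := ha.exists_remainderKernel_sqrt_bound N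
    exact ⟨fun ε => C * √ε, hsqrt C, hC⟩
  · refine squeeze_zero' (g := fun ε => C * √ε * S) (Eventually.of_forall fun _ => norm_nonneg _)
      ?_ (by simpa using (hsqrt C).mul_const S)
    filter_upwards [Ioo_mem_nhdsGT hε₀] with ε hε
    exact (hR ε hε).2
  · obtain ⟨C₁, hC₁, h₁⟩ := ha.exists_kernel_bound_uniform hε hb
    obtain ⟨C₂, hC₂, h₂⟩ := ha.conj.exists_kernel_bound_uniform hε (fun k => by
      obtain ⟨B, hB⟩ := hb k
      refine ⟨B, fun x ω s hs => ?_⟩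
      have h := hB x ω s hs
      rw [← RCLike.norm_conj, ← derivS_conj hq k (a ε x ω) hs] at h
      exact h)
    obtain ⟨A, hA, -⟩ := exists_boundedExtension hκ hS hC₁ h₁
    obtain ⟨A', hA', -⟩ := exists_boundedExtension hκ hS hC₂ h₂
    refine ⟨A, A', hA, hA', adjoint_sub_eq_of_isBoundedExtension (T := Op G q (a ε))
      (S := Op G q (conjSymbol (a ε))) hA hA' (hR ε hε).1 ?_ ?_⟩
    · rw [hop ε hε]
      exact dense_finSupp
    · rw [hdom ε hε]
      exact dense_finSupp
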